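/- Let $P\subset\mathbb C$ be finite, $\Omega=\mathbb C\setminus P$, and let $f:\Omega\to\mathbb C$ be a non-degenerate harmonic mapping with set of poles $P$. That is: (1) $\Delta f=0$ on $\Omega$, and $\lim_{z\to p}f(z)=\infty$ for every $p\in P$; (2) near each $p\in P$, $$f(z)=\sum_{k\ge -n}a_k(z-p)^k+\overline{\sum_{k\ge -n}b_k(z-p)^k}+c\log|z-p|$$ with some $n\ge 1$ and $|a_{-n}|\ne|b_{-n}|$; (3) the Jacobian $J_f=|\partial_zf|^2-|\partial_{\bar z}f|^2$ is positive for all sufficiently large $|z|$. Let $\mathcal C=\{z\in\Omega: J_f(z)=0\}$ be the critical set, let $\omega=\overline{\partial_{\bar z}f}/\partial_zf$ be the second complex dilatation, a meromorphic function on $\Omega$ with removable singularities removed, and let $\mathcal M=\{z\in\mathcal C:|\omega(z)|\neq1\}$. For a connected component $\Gamma$ of $\mathcal C\setminus\mathcal M$, a critical curve for $\Gamma$ is a closed curve $\gamma:[a,b]\to\mathbb C$, $a<b$, with trace $\Gamma$, with $\omega(\gamma(t))=e^{it}$ for all $t\in[a,b]$, and passing exactly once (for $t\in[a,b)$) through every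 point of $\Gamma$ where $\omega'\ne0$. The set $\mathcal C\setminus\mathcal M$ has only finitely many components, and each of them has a critical curve. Let $\mathrm{crit}$ consist of one critical curve (any choice) for each component. Let $\eta\in\mathbb C\setminus f(\mathcal C)$ be such that $\infty$ is an isolated exceptional point of $f-\eta$, i.e. $f(z)\ne\eta$ for all sufficiently large $|z|$. Then the number $N_\eta(f)$ of pre-images of $\eta$ under $f$ in $\Omega$ is finite, and $$N_\eta(f)=2\sum_{\gamma\in\mathrm{crit}}\mathrm{wind}(f\circ\gamma;\eta)+P(f)-\mathrm{ind}(f-\eta;\infty).$$ Here $\mathrm{wind}(f\circ\gamma;\eta)$ is the winding number of the closed curve $f\circ\gamma$ about $\eta$, and $P(f)=\sum_{p\in P}|\mathrm{ind}(f;p)|$, where the Poincaré index $\mathrm{ind}(f;p)$ is the change of argument of $f$, divided by $2\pi$, along any sufficiently small positively oriented circle about $p$; $\mathrm{ind}(f-\eta;\infty)$ is the change of argument of $f-\eta$, divided by $2\pi$, along any sufficiently large negatively oriented circle about $0$. -/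

import Mathlib

open Set Filter Topology

namespace HarmonicMapping

noncomputable section

/-- The Wirtinger derivative `∂f/∂z = (∂ₓ f - i ∂ᵧ f) / 2`. -/
def dz (f : ℂ → ℂ) (z : ℂ) : ℂ :=
  (fderiv ℝ f z 1 - Complex.I * fderiv ℝ f z Complex.I) / 2

/-- The Wirtinger derivative `∂f/∂z̄ = (∂ₓ f + i ∂ᵧ f) / 2`. -/
def dzbar (f : ℂ → ℂ) (z : ℂ) : ℂ :=
  (fderiv ℝ f z 1 + Complex.I * fderiv ℝ f z Complex.I) / 2

/-- The Jacobian `|∂f/∂z|² - |∂f/∂z̄|²`. -/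
def jacobian (f : ℂ → ℂ) (z : ℂ) : ℝ :=
  ‖dz f z‖ ^ 2 - ‖dzbar f z‖ ^ 2

/-- `f`, harmonic on a punctured neighbourhood of `p`, is there of the form
`∑_{k ≥ -n} a_k (z - p)^k + conj (∑_{k ≥ -n} b_k (z - p)^k) + c log |z - p|` with `n ≥ 1` and
`|a_{-n}| ≠ |b_{-n}|`. Here `A z = ∑_{k ≥ 0} a_{k-n} (z - p)^k` and
`B z = ∑_{k ≥ 0} b_{k-n} (z - p)^k`. -/
def HasNondegenerateForm (f : ℂ → ℂ) (p : ℂ) : Prop :=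
  ∃ (n : ℕ) (A B : ℂ → ℂ) (c : ℂ), 1 ≤ n ∧ AnalyticAt ℂ A p ∧ AnalyticAt ℂ B p ∧
    ‖A p‖ ≠ ‖B p‖ ∧
    ∀ᶠ z in 𝓝[≠] p, f z = A z / (z - p) ^ n + starRingEnd ℂ (B z / (z - p) ^ n)
      + c * (Real.log ‖z - p‖ : ℂ)

/-- `f` is a non-degenerate harmonic mapping on `ℂ \ P`, where `P` is its finite set of poles.
The values of `f` on `P` are irrelevant. -/
structure IsNondegenerate (f : ℂ → ℂ) (P : Finset ℂ) : Prop where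
  harmonic : InnerProductSpace.HarmonicOnNhd f ((P : Set ℂ)ᶜ)
  pole : ∀ p ∈ P, Tendsto f (𝓝[≠] p) (Bornology.cobounded ℂ)
  pole_form : ∀ p ∈ P, HasNondegenerateForm f p
  sense_preserving_at_infty : ∀ᶠ z in Bornology.cobounded ℂ, 0 < jacobian f z

/-- The critical set `𝒞` of `f : ℂ \ P → ℂ`. -/
def criticalSet (f : ℂ → ℂ) (P : Finset ℂ) : Set ℂ :=
  {z | z ∉ P ∧ jacobian f z = 0}

/-- The second complex dilatation `ω = conj (∂f/∂z̄) / (∂f/∂z)` on `ℂ \ P`, with removable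
singularities removed (the normal form of the meromorphic quotient; at a pole of `ω` the normal
form has the value `0`, so that poles of `ω` do not lie on the level set `|ω| = 1`). -/
def dilatation (f : ℂ → ℂ) (P : Finset ℂ) : ℂ → ℂ :=
  toMeromorphicNFOn (fun z => starRingEnd ℂ (dzbar f z) / dz f z) ((P : Set ℂ)ᶜ)

/-- The set `ℳ` of the critical points with `|ω| ≠ 1`. -/
def exceptionalSet (f : ℂ → ℂ) (P : Finset ℂ) : Set ℂ :=
  {z | z ∈ criticalSet f P ∧ ‖dilatation f P z‖ ≠ 1}

/-- The connected components of `𝒞 \ ℳ`. -/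
def criticalComponents (f : ℂ → ℂ) (P : Finset ℂ) : Set (Set ℂ) :=
  {Γ | ∃ z ∈ criticalSet f P \ exceptionalSet f P,
    Γ = connectedComponentIn (criticalSet f P \ exceptionalSet f P) z}

/-- A curve `[a, b] → ℂ`; the values of `toFun` outside `[a, b]` are irrelevant. -/
structure Curve where
  a : ℝ
  b : ℝ
  a_lt_b : a < b
  toFun : ℝ → ℂ
  continuousOn : ContinuousOn toFun (Icc a b)

/-- `γ` is a critical curve of `f` parametrizing the component `Γ` of `𝒞 \ ℳ`: a closed curve with
trace `Γ` and `ω (γ t) = e^{it}`, which travels through every critical arc once. The critical arcs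
meet at the zeros of `ω'`, so the last condition is that every point of `Γ` with `ω' ≠ 0` is
visited exactly once. -/
structure IsCriticalCurve (f : ℂ → ℂ) (P : Finset ℂ) (Γ : Set ℂ) (γ : Curve) : Prop where
  closed : γ.toFun γ.a = γ.toFun γ.b
  trace : γ.toFun '' Icc γ.a γ.b = Γ
  dilatation_eq : ∀ t ∈ Icc γ.a γ.b,
    dilatation f P (γ.toFun t) = Complex.exp (t * Complex.I)
  once : ∀ z ∈ Γ, deriv (dilatation f P) z ≠ 0 → ∃! t, t ∈ Ico γ.a γ.b ∧ γ.toFun t = z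

/-- `θ` is a continuous choice of the argument of `g` on `[a, b]` (in particular `g` has no zero
there). -/
def IsArgumentOn (g : ℝ → ℂ) (a b : ℝ) (θ : ℝ → ℝ) : Prop :=
  ContinuousOn θ (Icc a b) ∧
    ∀ t ∈ Icc a b, g t ≠ 0 ∧ g t = ‖g t‖ * Complex.exp (θ t * Complex.I)

open Classical in
/-- The change of the argument of `g` along `[a, b]`, divided by `2π`. It does not depend on the
choice of the continuous argument, which exists if `g` is continuous and non-zero on `[a, b]`. -/
def argChange (g : ℝ → ℂ) (a b : ℝ) : ℝ :=
  if h : ∃ θ, IsArgumentOn g a b θ then (h.choose b - h.choose a) / (2 * Real.pi) else 0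

/-- The winding `W(f; γ)` of `f` on `γ`. The winding number of `f ∘ γ` about `η` is
`winding (fun z => f z - η) γ`. -/
def winding (f : ℂ → ℂ) (γ : Curve) : ℝ :=
  argChange (fun t => f (γ.toFun t)) γ.a γ.b

/-- The Poincaré index of `f` at an isolated exceptional point `p ∈ ℂ`: the winding of `f` on all
sufficiently small positively oriented circles about `p`. -/
def index (f : ℂ → ℂ) (p : ℂ) : ℝ :=
  limUnder (𝓝[>] (0 : ℝ)) fun r =>
    argChange (fun t => f (p + r * Complex.exp (t * Complex.I))) 0 (2 * Real.pi)

/-- The Poincaré index of `f` at the isolated exceptional point `∞`: the winding of `f` on all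
sufficiently large negatively oriented circles about `0`. -/
def indexInfty (f : ℂ → ℂ) : ℝ :=
  limUnder atTop fun R : ℝ =>
    argChange (fun t => f (R * Complex.exp (-(t * Complex.I)))) 0 (2 * Real.pi)

/-- The pre-images of `η` under `f : ℂ \ P → ℂ`. -/
def preimages (f : ℂ → ℂ) (P : Finset ℂ) (η : ℂ) : Set ℂ :=
  {z | z ∉ P ∧ f z = η}

/-- The number of poles, counted with the absolute values of their Poincaré indices. -/
def poleCount (f : ℂ → ℂ) (P : Finset ℂ) : ℝ :=
  ∑ p ∈ P, |index f p|

end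

end HarmonicMapping

/-!
The dilatation is a rational function `u / v` in lowest terms with `|u / v| < 1` near `∞`, so the
critical set off `𝓜` is `|u| = |v|` and a critical curve is a path of roots of `u - e^{it} v`.
Followed continuously in `t`, these roots are permuted after one period; exchanging paths that meet
makes the cycles of this monodromy permutation correspond exactly to the components of `|u| = |v|`,
which gives the critical curves. Continuous enumerations of the roots exist because paths lift
through the quotient of `ℂⁿ` by the symmetric group.

On a closed set avoiding its zeros and poles, `f - η` equals `∏ (z - a) ^ n a * exp ℓ` with `ℓ`
continuous. Hence its winding along a closed curve is `∑ n a` times the winding of the curve about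
`a`, and its index at `∞` is `-∑ n a`. The product over all critical curves of `x - γ` is, along
one period, the monic multiple of `u(x) - e^{it} v(x)`; so the total winding of the critical curves
about `x` is `0` if `|u(x)| < |v(x)|` and `-1` if `|u(x)| > |v(x)|`. Doubling it and adding one
turns the local index `± 1` of a zero into a count, and that of a pole into `-|ind(f; p)|`.
-/

namespace HarmonicMapping

theorem exists_continuous_log {X : Type*} [TopologicalSpace X] [SimplyConnectedSpace X]
    [LocallyPathConnectedSpace X] {g : X → ℂ} (hg : Continuous g) (h0 : ∀ x, g x ≠ 0) :
    ∃ l : X → ℂ, Continuous l ∧ ∀ x, Complex.exp (l x) = g x := by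
  obtain ⟨x₀⟩ : Nonempty X := inferInstance
  obtain ⟨l, ⟨-, hl⟩, -⟩ := Complex.isCoveringMapOn_exp.existsUnique_continuousMap_lifts
    (⟨g, hg⟩ : C(X, ℂ)) (a₀ := x₀) (Complex.exp_log (h0 x₀)) (fun x => h0 x)
  exact ⟨l, l.continuous, fun x => congrFun hl x⟩

theorem exists_continuousOn_log_Icc {g : ℝ → ℂ} {a b : ℝ} (hab : a ≤ b)
    (hg : ContinuousOn g (Icc a b)) (h0 : ∀ t ∈ Icc a b, g t ≠ 0) :
    ∃ l : ℝ → ℂ, ContinuousOn l (Icc a b) ∧ ∀ t ∈ Icc a b, Complex.exp (l t) = g t := by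
  obtain ⟨l, hl, hl'⟩ := exists_continuous_log (X := ℝ)
    (g := IccExtend hab (fun t : Icc a b => g t))
    ((continuousOn_iff_continuous_domRestrict.1 hg).Icc_extend')
    (fun t => h0 _ (projIcc a b hab t).2)
  refine ⟨l, hl.continuousOn, fun t ht => ?_⟩
  rw [hl', IccExtend_of_mem hab _ ht]

theorem sub_eq_sub_of_exp_eq {X : Type*} [TopologicalSpace X] {s : Set X} (hs : IsPreconnected s)
    {l m : X → ℂ} (hl : ContinuousOn l s) (hm : ContinuousOn m s)
    (h : ∀ x ∈ s, Complex.exp (l x) = Complex.exp (m x)) {x y : X} (hx : x ∈ s) (hy : y ∈ s) :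
    l x - m x = l y - m y := by
  have := NormedSpace.discreteTopology_zmultiples (2 * Real.pi * Complex.I : ℂ)
  refine hs.constant_of_mapsTo
    (T := (AddSubgroup.zmultiples (2 * Real.pi * Complex.I : ℂ) : Set ℂ))
    (f := fun x => l x - m x) ⟨this⟩ (hl.sub hm) (fun z hz => ?_) hx hy
  obtain ⟨n, hn⟩ := Complex.exp_eq_exp_iff_exists_int.1 (h z hz)
  exact ⟨n, by simp [hn]⟩

theorem IsArgumentOn.argChange_eq {g : ℝ → ℂ} {a b : ℝ} (hab : a ≤ b) {θ : ℝ → ℝ}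
    (h : IsArgumentOn g a b θ) : argChange g a b = (θ b - θ a) / (2 * Real.pi) := by
  have hex : ∃ θ, IsArgumentOn g a b θ := ⟨θ, h⟩
  rw [argChange, dif_pos hex]
  have h' := hex.choose_spec
  set φ := hex.choose
  have hconst := sub_eq_sub_of_exp_eq (s := Icc a b) isPreconnected_Icc
    (l := fun t => (φ t : ℂ) * Complex.I) (m := fun t => (θ t : ℂ) * Complex.I)
    ((Complex.continuous_ofReal.comp_continuousOn h'.1).mul continuousOn_const)
    ((Complex.continuous_ofReal.comp_continuousOn h.1).mul continuousOn_const)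
    (fun t ht => by
      have h0 : (‖g t‖ : ℂ) ≠ 0 := by simpa using (h.2 t ht).1
      exact mul_left_cancel₀ h0 ((h'.2 t ht).2.symm.trans (h.2 t ht).2))
    (right_mem_Icc.2 hab) (left_mem_Icc.2 hab)
  have him : φ b - θ b = φ a - θ a := by simpa using congrArg Complex.im hconst
  congr 1
  linarith

theorem argChange_eq_of_log {g : ℝ → ℂ} {a b : ℝ} (hab : a ≤ b) {l : ℝ → ℂ}
    (hl : ContinuousOn l (Icc a b)) (h : ∀ t ∈ Icc a b, Complex.exp (l t) = g t) :
    argChange g a b = (l b - l a).im / (2 * Real.pi) := by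
  have harg : IsArgumentOn g a b fun t => (l t).im := by
    refine ⟨Complex.continuous_im.comp_continuousOn hl, fun t ht => ?_⟩
    rw [← h t ht]
    refine ⟨Complex.exp_ne_zero _, ?_⟩
    rw [Complex.norm_exp, Complex.ofReal_exp, ← Complex.exp_add, Complex.re_add_im]
  rw [harg.argChange_eq hab, Complex.sub_im]

theorem argChange_congr {f g : ℝ → ℂ} {a b : ℝ} (h : EqOn f g (Icc a b)) :
    argChange f a b = argChange g a b := by
  classical
  have : IsArgumentOn f a b = IsArgumentOn g a b := by
    funext θ
    refine propext (and_congr_right fun _ => forall₂_congr fun t ht => ?_)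
    rw [h ht]
  exact congrArg (fun A : (ℝ → ℝ) → Prop =>
    if h : ∃ θ, A θ then (h.choose b - h.choose a) / (2 * Real.pi) else 0) this

theorem argChange_exp {a b : ℝ} (hab : a ≤ b) {l : ℝ → ℂ} (hl : ContinuousOn l (Icc a b)) :
    argChange (fun t => Complex.exp (l t)) a b = (l b - l a).im / (2 * Real.pi) :=
  argChange_eq_of_log hab hl fun _ _ => rfl

theorem argChange_const {a b : ℝ} (hab : a ≤ b) {w : ℂ} (hw : w ≠ 0) :
    argChange (fun _ => w) a b = 0 := by
  rw [argChange_eq_of_log hab continuousOn_const fun _ _ => Complex.exp_log hw]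
  simp

theorem argChange_mul {f g : ℝ → ℂ} {a b : ℝ} (hab : a ≤ b) (hf : ContinuousOn f (Icc a b))
    (hf0 : ∀ t ∈ Icc a b, f t ≠ 0) (hg : ContinuousOn g (Icc a b))
    (hg0 : ∀ t ∈ Icc a b, g t ≠ 0) :
    argChange (fun t => f t * g t) a b = argChange f a b + argChange g a b := by
  obtain ⟨l, hl, hlf⟩ := exists_continuousOn_log_Icc hab hf hf0
  obtain ⟨m, hm, hmg⟩ := exists_continuousOn_log_Icc hab hg hg0
  rw [argChange_eq_of_log hab hl hlf, argChange_eq_of_log hab hm hmg,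
    argChange_eq_of_log hab (l := fun t => l t + m t) (hl.add hm) fun t ht => by
      rw [Complex.exp_add, hlf t ht, hmg t ht], add_sub_add_comm, Complex.add_im, add_div]

theorem argChange_neg {f : ℝ → ℂ} {a b : ℝ} (hab : a ≤ b) (hf : ContinuousOn f (Icc a b))
    (hf0 : ∀ t ∈ Icc a b, f t ≠ 0) : argChange (fun t => -f t) a b = argChange f a b := by
  have hneg : (-1 : ℂ) ≠ 0 := neg_ne_zero.2 one_ne_zero
  simp only [← neg_one_mul (f _)]
  rw [argChange_mul hab continuousOn_const (fun _ _ => hneg) hf hf0, argChange_const hab hneg,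
    zero_add]

theorem argChange_zpow {f : ℝ → ℂ} {a b : ℝ} (hab : a ≤ b) (hf : ContinuousOn f (Icc a b))
    (hf0 : ∀ t ∈ Icc a b, f t ≠ 0) (n : ℤ) :
    argChange (fun t => f t ^ n) a b = n * argChange f a b := by
  obtain ⟨l, hl, hlf⟩ := exists_continuousOn_log_Icc hab hf hf0
  rw [argChange_eq_of_log hab hl hlf,
    argChange_eq_of_log hab (l := fun t => n * l t) (continuousOn_const.mul hl) fun t ht => by
      rw [Complex.exp_int_mul, hlf t ht], ← mul_sub, mul_div_assoc', ← Complex.ofReal_intCast,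
      Complex.im_ofReal_mul]

theorem argChange_prod {ι : Type*} (s : Finset ι) {g : ι → ℝ → ℂ} {a b : ℝ} (hab : a ≤ b)
    (hg : ∀ i ∈ s, ContinuousOn (g i) (Icc a b)) (hg0 : ∀ i ∈ s, ∀ t ∈ Icc a b, g i t ≠ 0) :
    argChange (fun t => ∏ i ∈ s, g i t) a b = ∑ i ∈ s, argChange (g i) a b := by
  classical
  induction s using Finset.induction_on with
  | empty => simpa using argChange_const hab one_ne_zero
  | insert i s hi ih =>
    simp only [Finset.forall_mem_insert] at hg hg0
    simp only [Finset.prod_insert hi, Finset.sum_insert hi]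
    rw [argChange_mul hab hg.1 hg0.1 (continuousOn_finsetProd _ hg.2)
      fun t ht => Finset.prod_ne_zero_iff.2 fun j hj => hg0.2 j hj t ht, ih hg.2 hg0.2]

theorem argChange_add_argChange {g : ℝ → ℂ} {a b c : ℝ} (hab : a ≤ b) (hbc : b ≤ c)
    (hg : ContinuousOn g (Icc a c)) (hg0 : ∀ t ∈ Icc a c, g t ≠ 0) :
    argChange g a b + argChange g b c = argChange g a c := by
  obtain ⟨l, hl, hlg⟩ := exists_continuousOn_log_Icc (hab.trans hbc) hg hg0
  have hab' : Icc a b ⊆ Icc a c := Icc_subset_Icc_right hbc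
  have hbc' : Icc b c ⊆ Icc a c := Icc_subset_Icc_left hab
  rw [argChange_eq_of_log (hab.trans hbc) hl hlg,
    argChange_eq_of_log hab (hl.mono hab') fun t ht => hlg t (hab' ht),
    argChange_eq_of_log hbc (hl.mono hbc') fun t ht => hlg t (hbc' ht)]
  simp only [Complex.sub_im]
  ring

theorem argChange_comp_add_right {g : ℝ → ℂ} {a b : ℝ} (hab : a ≤ b) (d : ℝ)
    (hg : ContinuousOn g (Icc (a + d) (b + d))) (hg0 : ∀ t ∈ Icc (a + d) (b + d), g t ≠ 0) :
    argChange (fun t => g (t + d)) a b = argChange g (a + d) (b + d) := by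
  obtain ⟨l, hl, hlg⟩ := exists_continuousOn_log_Icc (by gcongr) hg hg0
  have hmaps : MapsTo (· + d) (Icc a b) (Icc (a + d) (b + d)) := fun t ht =>
    ⟨by simpa using ht.1, by simpa using ht.2⟩
  rw [argChange_eq_of_log (by gcongr) hl hlg,
    argChange_eq_of_log hab (hl.comp (by fun_prop) hmaps) fun t ht => hlg _ (hmaps ht)]
  rfl

theorem argChange_sum_range {g : ℝ → ℂ} {T : ℝ} (hT : 0 ≤ T) (m : ℕ)
    (hg : ContinuousOn g (Icc 0 (m * T))) (hg0 : ∀ t ∈ Icc 0 (m * T), g t ≠ 0) :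
    ∑ k ∈ Finset.range m, argChange (fun t => g (t + k * T)) 0 T = argChange g 0 (m * T) := by
  induction m with
  | zero =>
    have h0 : g 0 ≠ 0 := hg0 0 (by simp)
    rw [argChange_congr (g := fun _ => g 0) fun t ht => by
        rw [show t = 0 by simpa using ht]]
    simp [argChange_const, h0]
  | succ m ih =>
    have hm : (m : ℝ) * T ≤ (m + 1 : ℕ) * T := by gcongr; simp
    have hsub : Icc 0 (m * T) ⊆ Icc 0 ((m + 1 : ℕ) * T) := Icc_subset_Icc_right hm
    have hsub' : Icc (m * T) ((m + 1 : ℕ) * T) ⊆ Icc 0 ((m + 1 : ℕ) * T) :=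
      Icc_subset_Icc_left (by positivity)
    have heq : T + m * T = (m + 1 : ℕ) * T := by push_cast; ring
    rw [Finset.sum_range_succ, ih (hg.mono hsub) fun t ht => hg0 t (hsub ht),
      argChange_comp_add_right hT, zero_add, heq,
      argChange_add_argChange (by positivity) hm hg hg0]
    · rw [zero_add, heq]; exact hg.mono hsub'
    · rw [zero_add, heq]; exact fun t ht => hg0 t (hsub' ht)

theorem argChange_periodic_eq {g : ℝ → ℂ} (hg : Continuous g) (hg0 : ∀ t, g t ≠ 0) {T : ℝ}
    (hT : 0 ≤ T) (hper : Function.Periodic g T) (a b : ℝ) :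
    argChange g a (a + T) = argChange g b (b + T) := by
  obtain ⟨l, hl, hlg⟩ := exists_continuous_log hg hg0
  have hexp : ∀ t, Complex.exp (l (t + T)) = Complex.exp (l t) := fun t => by
    rw [hlg, hlg, hper]
  rw [argChange_eq_of_log (le_add_of_nonneg_right hT) hl.continuousOn fun t _ => hlg t,
    argChange_eq_of_log (le_add_of_nonneg_right hT) hl.continuousOn fun t _ => hlg t,
    sub_eq_sub_of_exp_eq (l := fun t => l (t + T)) isPreconnected_univ
      (hl.comp (continuous_add_const T)).continuousOn hl.continuousOn (fun t _ => hexp t)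
      (mem_univ a) (mem_univ b)]

theorem one_sub_mem_slitPlane {w : ℂ} (hw : ‖w‖ < 1) : 1 - w ∈ Complex.slitPlane := by
  left
  have := (Complex.re_le_norm w).trans_lt hw
  rw [Complex.sub_re, Complex.one_re]
  linarith

theorem argChange_one_sub_eq_zero {w : ℝ → ℂ} {a b : ℝ} (hab : a ≤ b)
    (hw : ContinuousOn w (Icc a b)) (hw1 : ∀ t ∈ Icc a b, ‖w t‖ < 1) (hclosed : w a = w b) :
    argChange (fun t => 1 - w t) a b = 0 := by
  rw [argChange_eq_of_log hab (l := fun t => Complex.log (1 - w t))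
    ((continuousOn_const.sub hw).clog fun t ht => one_sub_mem_slitPlane (hw1 t ht))
    fun t ht => Complex.exp_log (Complex.slitPlane_ne_zero (one_sub_mem_slitPlane (hw1 t ht)))]
  simp [hclosed]

theorem argChange_sub_eq_left {f g : ℝ → ℂ} {a b : ℝ} (hab : a ≤ b)
    (hf : ContinuousOn f (Icc a b)) (hg : ContinuousOn g (Icc a b))
    (hfg : ∀ t ∈ Icc a b, ‖g t‖ < ‖f t‖) (hfab : f a = f b) (hgab : g a = g b) :
    argChange (fun t => f t - g t) a b = argChange f a b := by
  have hf0 : ∀ t ∈ Icc a b, f t ≠ 0 := fun t ht =>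
    norm_pos_iff.1 ((norm_nonneg _).trans_lt (hfg t ht))
  have hquot : ∀ t ∈ Icc a b, ‖g t / f t‖ < 1 := fun t ht => by
    rw [norm_div]
    exact (div_lt_one (norm_pos_iff.2 (hf0 t ht))).2 (hfg t ht)
  have hcont : ContinuousOn (fun t => g t / f t) (Icc a b) := hg.div hf hf0
  calc argChange (fun t => f t - g t) a b
      = argChange (fun t => f t * (1 - g t / f t)) a b := argChange_congr fun t ht => by
        rw [mul_sub, mul_one, mul_div_cancel₀ _ (hf0 t ht)]
    _ = argChange f a b + argChange (fun t => 1 - g t / f t) a b :=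
        argChange_mul hab hf hf0 (continuousOn_const.sub hcont) fun t ht =>
          Complex.slitPlane_ne_zero (one_sub_mem_slitPlane (hquot t ht))
    _ = argChange f a b := by
        rw [argChange_one_sub_eq_zero hab hcont hquot (by rw [hfab, hgab]), add_zero]

theorem argChange_exp_mul_I : argChange (fun t => Complex.exp (t * Complex.I)) 0 (2 * Real.pi) =
    1 := by
  rw [argChange_exp Real.two_pi_pos.le (by fun_prop)]
  simp [Real.pi_ne_zero]

theorem argChange_sub_exp_eq_zero {p q : ℂ} (h : ‖q‖ < ‖p‖) :
    argChange (fun t => p - Complex.exp (t * Complex.I) * q) 0 (2 * Real.pi) = 0 := by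
  rw [argChange_sub_eq_left Real.two_pi_pos.le continuousOn_const (by fun_prop)
    (fun t _ => by simpa [Complex.norm_exp_ofReal_mul_I] using h) rfl (by simp)]
  exact argChange_const Real.two_pi_pos.le (norm_pos_iff.1 ((norm_nonneg q).trans_lt h))

theorem argChange_sub_exp_eq_one {p q : ℂ} (h : ‖p‖ < ‖q‖) :
    argChange (fun t => p - Complex.exp (t * Complex.I) * q) 0 (2 * Real.pi) = 1 := by
  have hq : -q ≠ 0 := neg_ne_zero.2 (norm_pos_iff.1 ((norm_nonneg p).trans_lt h))
  calc argChange (fun t => p - Complex.exp (t * Complex.I) * q) 0 (2 * Real.pi)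
      = argChange (fun t => Complex.exp (t * Complex.I) * -q - -p) 0 (2 * Real.pi) :=
        argChange_congr fun t _ => by ring
    _ = argChange (fun t => Complex.exp (t * Complex.I) * -q) 0 (2 * Real.pi) :=
        argChange_sub_eq_left Real.two_pi_pos.le (by fun_prop) continuousOn_const
          (fun t _ => by simpa [Complex.norm_exp_ofReal_mul_I] using h) (by simp) rfl
    _ = 1 := by
        rw [argChange_mul Real.two_pi_pos.le (by fun_prop) (fun _ _ => Complex.exp_ne_zero _)
          continuousOn_const fun _ _ => hq, argChange_exp_mul_I,
          argChange_const Real.two_pi_pos.le hq, add_zero]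

theorem argChange_circle_neg {a : ℂ} {R : ℝ} (hR : ‖a‖ < R) :
    argChange (fun t => R * Complex.exp (-(t * Complex.I)) - a) 0 (2 * Real.pi) = -1 := by
  have hnorm : ‖(R : ℂ)‖ = R := by
    rw [Complex.norm_real, Real.norm_of_nonneg ((norm_nonneg a).trans hR.le)]
  have hR0 : (R : ℂ) ≠ 0 := norm_pos_iff.1 (by rw [hnorm]; exact (norm_nonneg a).trans_lt hR)
  have hexp : ∀ t : ℝ, ‖Complex.exp (-(t * Complex.I))‖ = 1 := fun t => by simp [Complex.norm_exp]
  rw [argChange_sub_eq_left Real.two_pi_pos.le (by fun_prop) continuousOn_const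
      (fun t _ => by rwa [norm_mul, hexp, mul_one, hnorm]) (by simp [Complex.exp_neg]) rfl,
    argChange_mul Real.two_pi_pos.le continuousOn_const (fun _ _ => hR0) (by fun_prop)
      (fun _ _ => Complex.exp_ne_zero _), argChange_const Real.two_pi_pos.le hR0,
    argChange_exp Real.two_pi_pos.le (by fun_prop)]
  simp [Real.pi_ne_zero]

/-- Near the isolated point `a`, the function `F` is `(z - a) ^ n` up to a factor with a continuous
logarithm. This determines the Poincaré index of `F` at `a`, which is `n`. -/
def HasLocalIndex (F : ℂ → ℂ) (a : ℂ) (n : ℤ) : Prop :=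
  ∃ L : ℂ → ℂ, (∀ᶠ z in 𝓝[≠] a, ContinuousAt L z) ∧
    ∀ᶠ z in 𝓝[≠] a, F z = (z - a) ^ n * Complex.exp (L z)

theorem HasLocalIndex.index_eq {F : ℂ → ℂ} {a : ℂ} {n : ℤ} (h : HasLocalIndex F a n) :
    index F a = n := by
  obtain ⟨L, hL, hF⟩ := h
  obtain ⟨r, hr, hball⟩ := Metric.mem_nhdsWithin_iff.1 (hL.and hF)
  refine Tendsto.limUnder_eq (tendsto_const_nhds.congr' ?_)
  filter_upwards [Ioo_mem_nhdsGT hr] with ρ hρ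
  have hρ0 : (ρ : ℂ) ≠ 0 := by exact_mod_cast hρ.1.ne'
  set c : ℝ → ℂ := fun t => ρ * Complex.exp (t * Complex.I) with hc
  have hcc : Continuous c := by fun_prop
  have hc0 : ∀ t, c t ≠ 0 := fun t => mul_ne_zero hρ0 (Complex.exp_ne_zero _)
  have hc1 : c 0 = c (2 * Real.pi) := by simp [hc]
  have hmem : ∀ t, a + c t ∈ Metric.ball a r ∩ {a}ᶜ := fun t =>
    ⟨by simpa [hc, abs_of_pos hρ.1, Complex.norm_exp_ofReal_mul_I] using hρ.2, by simpa using hc0 t⟩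
  have hLc : Continuous fun t => L (a + c t) := continuous_iff_continuousAt.2 fun t =>
    ContinuousAt.comp (hball (hmem t)).1 (by fun_prop)
  calc (n : ℝ)
      = n * argChange c 0 (2 * Real.pi) + argChange (fun t => Complex.exp (L (a + c t))) 0
          (2 * Real.pi) := by
        rw [argChange_mul Real.two_pi_pos.le continuousOn_const (fun _ _ => hρ0) (by fun_prop)
          (fun _ _ => Complex.exp_ne_zero _), argChange_const Real.two_pi_pos.le hρ0,
          argChange_exp_mul_I, argChange_exp Real.two_pi_pos.le hLc.continuousOn, hc1]
        simp
    _ = argChange (fun t => F (a + c t)) 0 (2 * Real.pi) := by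
        rw [← argChange_zpow Real.two_pi_pos.le hcc.continuousOn (fun t _ => hc0 t),
          ← argChange_mul Real.two_pi_pos.le
            (hcc.continuousOn.zpow₀ n fun t _ => Or.inl (hc0 t))
            (fun t _ => zpow_ne_zero n (hc0 t)) hLc.cexp.continuousOn
            fun _ _ => Complex.exp_ne_zero _]
        exact argChange_congr fun t _ => by simp only [(hball (hmem t)).2, add_sub_cancel_left]

theorem HasLocalIndex.congr {F G : ℂ → ℂ} {a : ℂ} {n : ℤ} (h : HasLocalIndex F a n)
    (hFG : G =ᶠ[𝓝[≠] a] F) : HasLocalIndex G a n := by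
  obtain ⟨L, hL, hF⟩ := h
  exact ⟨L, hL, hFG.trans hF⟩

theorem HasLocalIndex.mul {F G : ℂ → ℂ} {a : ℂ} {m n : ℤ} (hF : HasLocalIndex F a m)
    (hG : HasLocalIndex G a n) : HasLocalIndex (fun z => F z * G z) a (m + n) := by
  obtain ⟨L, hL, hFL⟩ := hF
  obtain ⟨M, hM, hGM⟩ := hG
  refine ⟨fun z => L z + M z, ?_, ?_⟩
  · filter_upwards [hL, hM] with z h₁ h₂ using h₁.add h₂
  · filter_upwards [hFL, hGM, self_mem_nhdsWithin] with z h₁ h₂ hz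
    rw [h₁, h₂, zpow_add₀ (sub_ne_zero.2 hz), Complex.exp_add]
    ring

theorem HasLocalIndex.eventually_ne_zero {F : ℂ → ℂ} {a : ℂ} {n : ℤ} (h : HasLocalIndex F a n) :
    ∀ᶠ z in 𝓝[≠] a, F z ≠ 0 := by
  obtain ⟨L, -, hF⟩ := h
  filter_upwards [hF, self_mem_nhdsWithin] with z hz hza
  rw [hz]
  exact mul_ne_zero (zpow_ne_zero n (sub_ne_zero.2 hza)) (Complex.exp_ne_zero _)

theorem hasLocalIndex_sub_zpow (a : ℂ) (n : ℤ) : HasLocalIndex (fun z => (z - a) ^ n) a n :=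
  ⟨0, Eventually.of_forall fun _ => continuousAt_const, Eventually.of_forall fun _ => by simp⟩

theorem hasLocalIndex_zero_of_norm_sub_lt {G : ℂ → ℂ} {a w : ℂ}
    (hG : ∀ᶠ z in 𝓝[≠] a, ContinuousAt G z) (hw : ∀ᶠ z in 𝓝[≠] a, ‖G z - w‖ < ‖w‖) :
    HasLocalIndex G a 0 := by
  obtain ⟨z₀, hz₀⟩ := hw.exists
  have hw0 : w ≠ 0 := norm_pos_iff.1 ((norm_nonneg _).trans_lt hz₀)
  have hs : ∀ z, ‖G z - w‖ < ‖w‖ → G z / w ∈ Complex.slitPlane := fun z hz => by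
    have : ‖1 - G z / w‖ < 1 := by
      rw [one_sub_div hw0, norm_div, norm_sub_rev]
      exact (div_lt_one (norm_pos_iff.2 hw0)).2 hz
    simpa using one_sub_mem_slitPlane this
  refine ⟨fun z => Complex.log w + Complex.log (G z / w), ?_, ?_⟩
  · filter_upwards [hG, hw] with z h1 h2
    exact continuousAt_const.add ((h1.div_const w).clog (hs z h2))
  · filter_upwards [hw] with z hz
    rw [zpow_zero, one_mul, Complex.exp_add, Complex.exp_log hw0,
      Complex.exp_log (Complex.slitPlane_ne_zero (hs z hz)), mul_div_cancel₀ _ hw0]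

theorem hasLocalIndex_zero_of_continuousAt {G : ℂ → ℂ} {a : ℂ}
    (hG : ∀ᶠ z in 𝓝 a, ContinuousAt G z) (hG0 : G a ≠ 0) : HasLocalIndex G a 0 := by
  refine hasLocalIndex_zero_of_norm_sub_lt (w := G a) (hG.filter_mono nhdsWithin_le_nhds) ?_
  have hlim : Tendsto (fun z => ‖G z - G a‖) (𝓝 a) (𝓝 0) :=
    tendsto_iff_norm_sub_tendsto_zero.1 hG.self_of_nhds
  exact (hlim.eventually (gt_mem_nhds (norm_pos_iff.2 hG0))).filter_mono nhdsWithin_le_nhds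

theorem exists_continuousAt_eventuallyEq_of_punctured {L : ℂ → ℂ} {a : ℂ} {U : Set ℂ}
    (hL : ∀ᶠ z in 𝓝[≠] a, ContinuousAt L z) (hU : U ∈ 𝓝 a) :
    ∃ M : ℂ → ℂ, (∀ z ≠ a, ContinuousAt M z) ∧ M =ᶠ[𝓝 a] L ∧ ∀ z ∉ U, M z = 0 := by
  obtain ⟨r, hr, hball⟩ := Metric.mem_nhds_iff.1
    (inter_mem hU (eventually_nhdsWithin_iff.1 hL))
  let χ : ContDiffBump a := ⟨r / 4, r / 2, by positivity, by linarith⟩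
  have hχ : ∀ z ∉ Metric.closedBall a (r / 2), χ z = 0 := fun z hz =>
    χ.zero_of_le_dist (not_le.1 hz).le
  refine ⟨fun z => χ z * L z, fun z hz => ?_, ?_, fun z hz => ?_⟩
  · by_cases hzr : z ∈ Metric.closedBall a (r / 2)
    · have hLz : ContinuousAt L z :=
        (hball (Metric.closedBall_subset_ball (by linarith) hzr)).2 hz
      exact (Complex.continuous_ofReal.comp χ.continuous).continuousAt.mul hLz
    · refine (continuousAt_const (y := (0 : ℂ))).congr ?_
      filter_upwards [Metric.isClosed_closedBall.isOpen_compl.mem_nhds hzr] with y hy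
      simp [hχ y hy]
  · filter_upwards [χ.eventuallyEq_one] with z hz
    simp [hz]
  · have hzr : z ∉ Metric.closedBall a (r / 2) := fun h =>
      hz (hball (Metric.closedBall_subset_ball (by linarith) h)).1
    simp [hχ z hzr]

/-- Off the finite set `S` the function `F` is continuous and without zeros, and `n a` is its
Poincaré index at `a ∈ S`: the divisor of `F`, poles included, is `∑ n a • a`. -/
structure HasDivisor (F : ℂ → ℂ) (S : Finset ℂ) (n : ℂ → ℤ) : Prop where
  continuousAt : ∀ z ∉ S, ContinuousAt F z
  ne_zero : ∀ z ∉ S, F z ≠ 0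
  hasLocalIndex : ∀ a ∈ S, HasLocalIndex F a (n a)

theorem HasLocalIndex.exists_eventuallyEq {F : ℂ → ℂ} {a : ℂ} {n : ℤ} (h : HasLocalIndex F a n)
    {U : Set ℂ} (hU : U ∈ 𝓝 a) :
    ∃ G : ℂ → ℂ, (∀ z ≠ a, ContinuousAt G z) ∧ (∀ z ≠ a, G z ≠ 0) ∧ F =ᶠ[𝓝[≠] a] G ∧
      ∀ z ∉ U, G z = (z - a) ^ n := by
  obtain ⟨L, hL, hF⟩ := h
  obtain ⟨M, hM, hML, hMU⟩ := exists_continuousAt_eventuallyEq_of_punctured hL hU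
  refine ⟨fun z => (z - a) ^ n * Complex.exp (M z), fun z hz => ?_, fun z hz => ?_, ?_,
    fun z hz => by simp [hMU z hz]⟩
  · exact ((continuousAt_id.sub continuousAt_const).zpow₀ n (Or.inl (sub_ne_zero.2 hz))).mul
      (hM z hz).cexp
  · exact mul_ne_zero (zpow_ne_zero n (sub_ne_zero.2 hz)) (Complex.exp_ne_zero _)
  · filter_upwards [hF, hML.filter_mono nhdsWithin_le_nhds] with z h₁ h₂
    rw [h₁, h₂]

theorem HasDivisor.exists_eq_zpow_mul {F : ℂ → ℂ} {a : ℂ} {S : Finset ℂ} {n : ℂ → ℤ}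
    [DecidableEq ℂ] (h : HasDivisor F (insert a S) n) (ha : a ∉ S) {U : Set ℂ} (hU : U ∈ 𝓝 a) :
    ∃ F₁ : ℂ → ℂ, HasDivisor F₁ S n ∧ ∀ z ∉ U, F z = (z - a) ^ n a * F₁ z := by
  obtain ⟨G, hGc, hG0, hFG, hGU⟩ :=
    (h.hasLocalIndex a (Finset.mem_insert_self a S)).exists_eventuallyEq hU
  set F₁ : ℂ → ℂ := Function.update (fun z => F z * (G z)⁻¹) a 1 with hF₁
  have hF₁_ne : ∀ z ≠ a, F₁ z = F z * (G z)⁻¹ := fun z hz => Function.update_of_ne hz _ _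
  have hF₁_ev : ∀ z ≠ a, F₁ =ᶠ[𝓝 z] fun z => F z * (G z)⁻¹ := fun z hz => by
    filter_upwards [isOpen_ne.mem_nhds hz] with y hy using hF₁_ne y hy
  have hF₁_self : F₁ =ᶠ[𝓝 a] 1 := by
    filter_upwards [eventually_nhdsWithin_iff.1 hFG] with y hy
    rcases eq_or_ne y a with rfl | hya
    · exact Function.update_self ..
    · rw [hF₁_ne y hya, hy hya, mul_inv_cancel₀ (hG0 y hya), Pi.one_apply]
  refine ⟨F₁, ⟨fun z hz => ?_, fun z hz => ?_, fun b hb => ?_⟩, fun z hz => ?_⟩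
  · rcases eq_or_ne z a with rfl | hza
    · exact continuousAt_const.congr hF₁_self.symm
    · exact ((h.continuousAt z (by simp [hza, hz])).mul
        ((hGc z hza).inv₀ (hG0 z hza))).congr (hF₁_ev z hza).symm
  · rcases eq_or_ne z a with rfl | hza
    · simp [hF₁]
    · rw [hF₁_ne z hza]
      exact mul_ne_zero (h.ne_zero z (by simp [hza, hz])) (inv_ne_zero (hG0 z hza))
  · have hba : b ≠ a := fun hba => ha (hba ▸ hb)
    have hGinv : HasLocalIndex (fun z => (G z)⁻¹) b 0 := by
      refine hasLocalIndex_zero_of_continuousAt ?_ (inv_ne_zero (hG0 b hba))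
      filter_upwards [isOpen_ne.mem_nhds hba] with y hy using (hGc y hy).inv₀ (hG0 y hy)
    simpa using ((h.hasLocalIndex b (Finset.mem_insert_of_mem hb)).mul hGinv).congr
      ((hF₁_ev b hba).filter_mono nhdsWithin_le_nhds)
  · have hza : z ≠ a := fun hza => hz (hza ▸ mem_of_mem_nhds hU)
    rw [hF₁_ne z hza, ← hGU z hz, mul_left_comm, mul_inv_cancel₀ (hG0 z hza), mul_one]

theorem HasDivisor.exists_log_factorization {F : ℂ → ℂ} {S : Finset ℂ} {n : ℂ → ℤ}
    (h : HasDivisor F S n) {K : Set ℂ} (hK : IsClosed K) (hKS : ∀ a ∈ S, a ∉ K) :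
    ∃ l : ℂ → ℂ, Continuous l ∧
      ∀ z ∈ K, F z = (∏ a ∈ S, (z - a) ^ n a) * Complex.exp (l z) := by
  classical
  induction S using Finset.induction_on generalizing F with
  | empty =>
    obtain ⟨l, hl, hlF⟩ := exists_continuous_log
      (continuous_iff_continuousAt.2 fun z => h.continuousAt z (Finset.notMem_empty z))
      (fun z => h.ne_zero z (Finset.notMem_empty z))
    exact ⟨l, hl, fun z _ => by simp [hlF]⟩
  | insert a S ha ih =>
    rw [Finset.forall_mem_insert] at hKS
    obtain ⟨F₁, hF₁, hF⟩ := h.exists_eq_zpow_mul ha (hK.isOpen_compl.mem_nhds hKS.1)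
    obtain ⟨l, hl, hlF⟩ := ih hF₁ hKS.2
    refine ⟨l, hl, fun z hz => ?_⟩
    rw [hF z (notMem_compl_iff.2 hz), hlF z hz, Finset.prod_insert ha, mul_assoc]

theorem HasDivisor.argChange_comp {F : ℂ → ℂ} {S : Finset ℂ} {n : ℂ → ℤ} (h : HasDivisor F S n)
    {c : ℝ → ℂ} {s t : ℝ} (hst : s ≤ t) (hc : ContinuousOn c (Icc s t))
    (hcS : ∀ x ∈ Icc s t, c x ∉ S) (hclosed : c s = c t) :
    argChange (fun x => F (c x)) s t = ∑ a ∈ S, n a * argChange (fun x => c x - a) s t := by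
  obtain ⟨l, hl, hF⟩ := h.exists_log_factorization (isCompact_Icc.image_of_continuousOn hc).isClosed
    fun a ha ⟨x, hx, hxa⟩ => hcS x hx (hxa ▸ ha)
  have hlc : ContinuousOn (fun x => l (c x)) (Icc s t) := hl.comp_continuousOn hc
  have hsub : ∀ a ∈ S, ContinuousOn (fun x => c x - a) (Icc s t) := fun a _ =>
    hc.sub continuousOn_const
  have hsub0 : ∀ a ∈ S, ∀ x ∈ Icc s t, c x - a ≠ 0 := fun a ha x hx h0 =>
    hcS x hx (sub_eq_zero.1 h0 ▸ ha)
  have hpow : ∀ a ∈ S, ContinuousOn (fun x => (c x - a) ^ n a) (Icc s t) := fun a ha =>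
    (hsub a ha).zpow₀ (n a) fun x hx => Or.inl (hsub0 a ha x hx)
  have hpow0 : ∀ a ∈ S, ∀ x ∈ Icc s t, (c x - a) ^ n a ≠ 0 := fun a ha x hx =>
    zpow_ne_zero _ (hsub0 a ha x hx)
  calc argChange (fun x => F (c x)) s t
      = argChange (fun x => (∏ a ∈ S, (c x - a) ^ n a) * Complex.exp (l (c x))) s t :=
        argChange_congr fun x hx => hF _ (mem_image_of_mem c hx)
    _ = ∑ a ∈ S, argChange (fun x => (c x - a) ^ n a) s t := by
        rw [argChange_mul hst (continuousOn_finsetProd _ hpow)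
          (fun x hx => Finset.prod_ne_zero_iff.2 fun a ha => hpow0 a ha x hx) hlc.cexp
          (fun _ _ => Complex.exp_ne_zero _), argChange_prod S hst hpow hpow0,
          argChange_exp hst hlc, hclosed]
        simp
    _ = ∑ a ∈ S, n a * argChange (fun x => c x - a) s t :=
        Finset.sum_congr rfl fun a ha => argChange_zpow hst (hsub a ha) (hsub0 a ha) (n a)

theorem HasDivisor.indexInfty_eq {F : ℂ → ℂ} {S : Finset ℂ} {n : ℂ → ℤ} (h : HasDivisor F S n) :
    indexInfty F = -∑ a ∈ S, (n a : ℝ) := by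
  obtain ⟨R₀, hR₀⟩ := S.finite_toSet.isBounded.exists_norm_le
  refine Tendsto.limUnder_eq (tendsto_const_nhds.congr' ?_)
  filter_upwards [eventually_gt_atTop R₀, eventually_ge_atTop 0] with R hR hR0
  have hnorm : ∀ t : ℝ, ‖(R : ℂ) * Complex.exp (-(t * Complex.I))‖ = R := fun t => by
    simp [Complex.norm_exp, abs_of_nonneg hR0]
  rw [h.argChange_comp Real.two_pi_pos.le (by fun_prop)
    (fun t _ ht => (hR₀ _ ht).not_gt (by rwa [hnorm])) (by simp [Complex.exp_neg]),
    ← Finset.sum_neg_distrib]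
  refine Finset.sum_congr rfl fun a ha => ?_
  rw [argChange_circle_neg ((hR₀ a ha).trans_lt hR), mul_neg_one]

theorem exists_eventually_hyperfilter_eq {α : Type*} [Finite α] (h : ℕ → α) :
    ∃ a, ∀ᶠ n in (hyperfilter ℕ : Filter ℕ), h n = a := by
  obtain ⟨a, ha⟩ := ((hyperfilter ℕ).map h).eq_pure_of_finite
  have hmem : {a} ∈ (hyperfilter ℕ).map h := ha ▸ Ultrafilter.mem_pure.2 rfl
  exact ⟨a, hmem⟩

section OrbitLifting

variable {E : Type*} [MetricSpace E]

theorem exists_pos_le_eq_of_dist_lt {S : Set E} (hS : S.Finite) {ε : ℝ} (hε : 0 < ε) :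
    ∃ η, 0 < η ∧ η ≤ ε ∧ ∀ p ∈ S, ∀ q ∈ S, dist p q < 3 * η → p = q := by
  have hpair : ∀ p ∈ S, ∀ q ∈ S, ∀ᶠ η in 𝓝[>] (0 : ℝ), dist p q < 3 * η → p = q := by
    intro p _ q _
    rcases eq_or_ne p q with rfl | hpq
    · exact Eventually.of_forall fun _ _ => rfl
    · have hpos : 0 < dist p q / 3 := div_pos (dist_pos.2 hpq) three_pos
      filter_upwards [Ioo_mem_nhdsGT hpos] with η hη hlt
      linarith [hη.2]
  have hall : ∀ᶠ η in 𝓝[>] (0 : ℝ), ∀ p ∈ S, ∀ q ∈ S, dist p q < 3 * η → p = q :=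
    (eventually_all_finite hS).2 fun p hp => (eventually_all_finite hS).2 (hpair p hp)
  obtain ⟨η, hsep, hη⟩ := (hall.and (Ioc_mem_nhdsGT hε)).exists
  exact ⟨η, hη.1, hη.2, hsep⟩

theorem dist_lt_of_chain {S : Set E} {η : ℝ}
    (hS : ∀ p ∈ S, ∀ q ∈ S, dist p q < 3 * η → p = q) {R : E → E → Prop}
    (hR : ∀ x y, R x y → dist x y < η ∧ ∃ q ∈ S, dist y q < η) {x y p : E}
    (hxy : Relation.ReflTransGen R x y) (hp : p ∈ S) (hx : dist x p < η) : dist y p < η := by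
  induction hxy with
  | refl => exact hx
  | @tail a b _ hab ih =>
    obtain ⟨hdist, q, hq, hbq⟩ := hR a b hab
    have hqp : dist q p < 3 * η := by
      linarith [dist_triangle4 q b a p, dist_comm q b, dist_comm a b]
    exact hS q hq p hp hqp ▸ hbq

variable {G : Type*} [Group G] [MulAction G E]

variable (G) in
/-- `x : ℝ → E` is uniformly continuous as a map to the orbit space of the isometric action of
`G` on `E`. -/
def UniformContinuousModOrbit (x : ℝ → E) : Prop :=
  ∀ ε > 0, ∃ δ > 0, ∀ s t, dist s t < δ → ∃ g : G, dist (x s) (g • x t) < ε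

variable [IsIsometricSMul G E]

theorem uniformContinuousModOrbit_comp_projIcc {x : ℝ → E}
    (hx : ∀ t₀, ∀ ε > 0, ∀ᶠ t in 𝓝 t₀, ∃ g : G, dist (g • x t) (x t₀) < ε) {a b : ℝ}
    (hab : a ≤ b) : UniformContinuousModOrbit G fun t => x (projIcc a b hab t) := by
  intro ε hε
  obtain ⟨δ, hδ, hcover⟩ := Metric.uniformity_basis_dist.lebesgue_number_lemma_nhds
    (isCompact_Icc (a := a) (b := b)) fun t₀ _ => hx t₀ (ε / 2) (half_pos hε)
  refine ⟨δ, hδ, fun s t hst => ?_⟩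
  have hproj : dist (projIcc a b hab s : ℝ) (projIcc a b hab t) < δ :=
    ((LipschitzWith.projIcc hab).dist_le_mul s t).trans_lt (by simpa using hst)
  obtain ⟨t₀, ht₀⟩ := hcover _ (projIcc a b hab s).2
  obtain ⟨g, hg⟩ := ht₀ (UniformSpace.mem_ball_self _ (Metric.dist_mem_uniformity hδ))
  obtain ⟨c, hc⟩ := ht₀ (show (projIcc a b hab t : ℝ) ∈ _ from hproj)
  refine ⟨g⁻¹ * c, ?_⟩
  rw [mul_smul, ← dist_smul g, smul_inv_smul]
  linarith [dist_triangle_right (g • x (projIcc a b hab s)) (c • x (projIcc a b hab t)) (x t₀)]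

theorem exists_smul_dist_smul_lt {y z : E} {ε : ℝ} (h : ∃ g : G, dist y (g • z) < ε) (c : G) :
    ∃ g : G, dist (c • y) (g • z) < ε := by
  obtain ⟨g, hg⟩ := h
  exact ⟨c * g, by rwa [mul_smul, dist_smul]⟩

theorem exists_seq_dist_smul_lt {y : ℕ → E} {ε : ℝ}
    (hy : ∀ k, ∃ g : G, dist (y k) (g • y (k + 1)) < ε) :
    ∃ c : ℕ → G, ∀ k, dist (c k • y k) (c (k + 1) • y (k + 1)) < ε := by
  choose next hnext using fun k => exists_smul_dist_smul_lt (hy k)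
  exact ⟨fun k => Nat.rec 1 next k, fun k => hnext k _⟩

variable (G) in
/-- `z` lies at distance less than `ε` from `y`, on the orbit of `x r` for some `r ∈ I`. -/
def IsOrbitStep (x : ℝ → E) (ε : ℝ) (I : Set ℝ) (y z : E) : Prop :=
  dist y z < ε ∧ ∃ r ∈ I, ∃ g : G, z = g • x r

theorem UniformContinuousModOrbit.exists_chain {x : ℝ → E} (hx : UniformContinuousModOrbit G x)
    {ε : ℝ} (hε : 0 < ε) :
    ∃ h : ℝ → G, ∀ s t, 0 ≤ s → s ≤ t →
      Relation.ReflTransGen (IsOrbitStep G x ε (Icc (s - ε) t)) (h s • x s) (h t • x t) := by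
  obtain ⟨δ₀, hδ₀, hstep⟩ := hx ε hε
  obtain ⟨δ, hδ, hδ'⟩ := exists_between (lt_min hε hδ₀)
  obtain ⟨hδε, hδδ₀⟩ := lt_min_iff.1 hδ'
  obtain ⟨c, hc⟩ := exists_seq_dist_smul_lt (y := fun k : ℕ => x (k * δ)) fun k =>
    hstep _ _ (by simpa [Real.dist_eq, ← sub_mul, abs_of_pos hδ] using hδδ₀)
  let κ : ℝ → ℕ := fun t => ⌊t / δ⌋₊
  have hκ {t : ℝ} (ht : 0 ≤ t) : κ t * δ ≤ t ∧ t - δ < κ t * δ := by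
    have hle := Nat.floor_le (div_nonneg ht hδ.le)
    have hlt := Nat.lt_floor_add_one (t / δ)
    rw [le_div_iff₀ hδ] at hle
    rw [div_lt_iff₀ hδ] at hlt
    exact ⟨hle, by linarith⟩
  have hend (t : ℝ) (ht : 0 ≤ t) : ∃ g : G, dist (c (κ t) • x (κ t * δ)) (g • x t) < ε :=
    exists_smul_dist_smul_lt (hstep _ _ (abs_lt.2 (by constructor <;> linarith [hκ ht]))) _
  choose! h hh using hend
  refine ⟨h, fun s t hs hst => ?_⟩
  have ht := hs.trans hst
  have hgrid : Relation.ReflTransGen (IsOrbitStep G x ε (Icc (s - ε) t))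
      (c (κ s) • x (κ s * δ)) (c (κ t) • x (κ t * δ)) := by
    refine (reflTransGen_of_succ_of_le (fun i j => j = i + 1 ∧ i ∈ Ico (κ s) (κ t))
      (fun i hi => ⟨rfl, hi⟩) (Nat.floor_mono (div_le_div_of_nonneg_right hst hδ.le))).lift
      (fun k : ℕ => c k • x (k * δ)) ?_
    rintro k _ ⟨rfl, hk⟩
    have hsk : (κ s : ℝ) * δ ≤ (k + 1 : ℕ) * δ := by gcongr; exact hk.1.trans k.le_succ
    have hkt : ((k + 1 : ℕ) : ℝ) * δ ≤ κ t * δ := by gcongr; exact hk.2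
    exact ⟨hc k, _, ⟨by linarith [hκ hs], hkt.trans (hκ ht).1⟩, _, rfl⟩
  have hfirst : IsOrbitStep G x ε (Icc (s - ε) t) (h s • x s) (c (κ s) • x (κ s * δ)) :=
    ⟨dist_comm (h s • x s) _ ▸ hh s hs, _, ⟨by linarith [hκ hs], by linarith [hκ hs]⟩, _, rfl⟩
  exact (hgrid.head hfirst).tail ⟨hh t ht, t, ⟨by linarith, le_rfl⟩, _, rfl⟩

/-- The lift is a pointwise limit, along an ultrafilter, of lifts with jumps tending to `0`; near
`t₀` these cannot leave the neighbourhood of a point of the finite orbit of `x t₀`. -/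
theorem UniformContinuousModOrbit.exists_continuousOn_smul [Finite G] {x : ℝ → E}
    (hx : UniformContinuousModOrbit G x) :
    ∃ g : ℝ → G, ContinuousOn (fun t => g t • x t) (Ici 0) := by
  choose h hh using fun n : ℕ => hx.exists_chain (Nat.one_div_pos_of_nat (α := ℝ) (n := n))
  choose g hg using fun t => exists_eventually_hyperfilter_eq fun n => h n t
  refine ⟨g, fun t₀ ht₀ => Metric.continuousWithinAt_iff.2 fun ε hε => ?_⟩
  let S := range fun c : G => c • x t₀
  obtain ⟨η, hη, hηε, hsep⟩ := exists_pos_le_eq_of_dist_lt (finite_range fun c : G => c • x t₀) hε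
  obtain ⟨δ, hδ, hnear⟩ := hx η hη
  have hstay {s t : ℝ} (hs : 0 ≤ s) (hst : s ≤ t) (hs₀ : t₀ - δ / 2 < s) (ht₀ : t < t₀ + δ)
      {p : E} (hp : p ∈ S) (hsp : dist (g s • x s) p < η) : dist (g t • x t) p < η := by
    have hsmall := (tendsto_one_div_add_atTop_nhds_zero_nat (𝕜 := ℝ)).eventually
      (gt_mem_nhds (lt_min hη (half_pos hδ)))
    obtain ⟨n, hn, hns, hnt⟩ := ((hsmall.filter_mono Nat.hyperfilter_le_atTop).and
      ((hg s).and (hg t))).exists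
    obtain ⟨hnη, hnδ⟩ := lt_min_iff.1 hn
    refine dist_lt_of_chain hsep ?_ (hns ▸ hnt ▸ hh n s t hs hst) hp hsp
    rintro y _ ⟨hy, r, hr, c, rfl⟩
    have hr₀ : dist r t₀ < δ := abs_lt.2 ⟨by linarith [hr.1], by linarith [hr.2]⟩
    obtain ⟨c', hc'⟩ := exists_smul_dist_smul_lt (hnear r t₀ hr₀) c
    exact ⟨hy.trans hnη, _, mem_range_self c', hc'⟩
  refine ⟨δ / 2, half_pos hδ, fun t ht htt₀ => ?_⟩
  obtain ⟨hlo, hhi⟩ := abs_lt.1 (Real.dist_eq t t₀ ▸ htt₀)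
  rcases le_total t₀ t with hle | hle
  · exact (hstay ht₀ hle (by linarith) (by linarith) (mem_range_self _) (by simpa)).trans_le hηε
  · obtain ⟨c, hc⟩ := exists_smul_dist_smul_lt (hnear t t₀ (htt₀.trans (half_lt_self hδ))) (g t)
    have hc₀ := hstay ht hle (by linarith) (by linarith) (mem_range_self c) hc
    have heq : g t₀ • x t₀ = c • x t₀ :=
      hsep _ (mem_range_self _) _ (mem_range_self c) (by linarith)
    exact heq ▸ hc.trans_le hηε

theorem exists_continuousOn_smul_Icc [Finite G] {x : ℝ → E}
    (hx : ∀ t₀, ∀ ε > 0, ∀ᶠ t in 𝓝 t₀, ∃ g : G, dist (g • x t) (x t₀) < ε) (T : ℝ) :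
    ∃ g : ℝ → G, ContinuousOn (fun t => g t • x t) (Icc 0 T) := by
  rcases le_or_gt 0 T with hT | hT
  · obtain ⟨g, hg⟩ := (uniformContinuousModOrbit_comp_projIcc hx hT).exists_continuousOn_smul
    refine ⟨g, (hg.mono Icc_subset_Ici_self).congr fun t ht => ?_⟩
    simp only [projIcc_of_mem hT ht]
  · exact ⟨1, by simp [Icc_eq_empty_of_lt hT]⟩

end OrbitLifting

section RootVector

open Polynomial
open scoped NNReal

variable {ι : Type*} [Fintype ι] {R : Type*} [CommRing R]

/-- The coordinates of `z` are the roots, with multiplicities, of the monic polynomial `p`. -/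
def IsRootVector (p : R[X]) (z : ι → R) : Prop := ∏ j, (X - C (z j)) = p

theorem IsRootVector.comp_perm {p : R[X]} {z : ι → R} (hz : IsRootVector p z)
    (σ : Equiv.Perm ι) : IsRootVector p (z ∘ σ) :=
  (Equiv.prod_comp σ fun j => X - C (z j)).trans hz

theorem IsRootVector.eval_eq_prod {p : R[X]} {z : ι → R} (hz : IsRootVector p z) (x : R) :
    p.eval x = ∏ j, (x - z j) := by
  simp [← show _ = p from hz, eval_prod]

theorem IsRootVector.eq_of_derivative_ne_zero {p : R[X]} {z : ι → R} (hz : IsRootVector p z)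
    {i j : ι} (hij : z i = z j) (hp : p.derivative.eval (z i) ≠ 0) : i = j := by
  classical
  contrapose! hp
  rw [← show _ = p from hz, derivative_prod_finset, eval_finsetSum]
  refine Finset.sum_eq_zero fun k _ => ?_
  obtain ⟨l, hlk, hl⟩ : ∃ l ≠ k, z i = z l := by
    rcases eq_or_ne i k with rfl | hik
    · exact ⟨j, hp.symm, hij⟩
    · exact ⟨i, hik, rfl⟩
  rw [eval_mul, eval_prod,
    Finset.prod_eq_zero (Finset.mem_erase.2 ⟨hlk, Finset.mem_univ l⟩) (by simp [hl]), zero_mul]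

variable [IsDomain R]

theorem IsRootVector.eval_eq_zero_iff {p : R[X]} {z : ι → R} (hz : IsRootVector p z) {x : R} :
    p.eval x = 0 ↔ ∃ j, z j = x := by
  simp only [hz.eval_eq_prod, Finset.prod_eq_zero_iff, Finset.mem_univ, true_and, sub_eq_zero,
    eq_comm (a := x)]

theorem IsRootVector.roots_eq {p : R[X]} {z : ι → R} (hz : IsRootVector p z) :
    p.roots = Finset.univ.val.map z := by
  rw [← show _ = p from hz, ← roots_multiset_prod_X_sub_C (Finset.univ.val.map z),
    Multiset.map_map]
  rfl

theorem IsRootVector.comp_of_injective {κ : Type*} [Fintype κ] {p : R[X]} {z : ι → R} {w : κ → R}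
    (hz : IsRootVector p z) (hzinj : Function.Injective z) (hwinj : Function.Injective w)
    (hw : ∀ x, p.eval x = 0 ↔ ∃ k, w k = x) : IsRootVector p w := by
  have hrange : range w = range z := by
    ext x
    rw [mem_range, mem_range, ← hw, hz.eval_eq_zero_iff]
  let e : κ ≃ ι := (Equiv.ofInjective w hwinj).trans
    ((Equiv.setCongr hrange).trans (Equiv.ofInjective z hzinj).symm)
  have he : ∀ k, z (e k) = w k := fun k => by
    simp [e, Equiv.apply_ofInjective_symm]
  rw [IsRootVector, ← show _ = p from hz, ← Equiv.prod_comp e fun j => X - C (z j)]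
  simp only [he]

theorem exists_comp_perm_eq_of_map_eq {α β : Type*} [Fintype α] {z y : α → β}
    (h : Finset.univ.val.map z = Finset.univ.val.map y) :
    ∃ σ : Equiv.Perm α, y ∘ σ = z := by
  classical
  have hcard (c : β) : Nonempty ({j // z j = c} ≃ {j // y j = c}) := by
    refine ⟨Fintype.equivOfCardEq ?_⟩
    have hcount := congrArg (Multiset.count c) h
    rw [Multiset.count_map, Multiset.count_map] at hcount
    rw [Fintype.card_subtype, Fintype.card_subtype]
    simpa [Finset.card_def, eq_comm] using hcount
  let e := fun c => (hcard c).some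
  exact ⟨(Equiv.sigmaFiberEquiv z).symm.trans
    ((Equiv.sigmaCongrRight e).trans (Equiv.sigmaFiberEquiv y)),
    funext fun j => (e (z j) ⟨j, rfl⟩).2⟩

theorem IsRootVector.exists_comp_perm_eq {p : R[X]} {z y : ι → R} (hz : IsRootVector p z)
    (hy : IsRootVector p y) : ∃ σ : Equiv.Perm ι, y ∘ σ = z :=
  exists_comp_perm_eq_of_map_eq (hz.roots_eq.symm.trans hy.roots_eq)

theorem exists_isRootVector {K : Type*} [Field K] [IsAlgClosed K] {p : K[X]} (hp : p.Monic)
    (hdeg : p.natDegree = Fintype.card ι) : ∃ z : ι → K, IsRootVector p z := by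
  classical
  have hcard : Fintype.card ι = Fintype.card p.roots := by
    rw [Multiset.card_coe, ← hdeg, (IsAlgClosed.splits p).natDegree_eq_card_roots]
  let e := Fintype.equivOfCardEq hcard
  refine ⟨fun i => (e i).1, (Equiv.prod_comp e fun x => X - C x.1).trans ?_⟩
  rw [Finset.prod, Multiset.map_univ p.roots fun x => X - C x]
  exact ((IsAlgClosed.splits p).eq_prod_roots_of_monic hp).symm

theorem IsRootVector.natDegree_eq {p : R[X]} {z : ι → R} (hz : IsRootVector p z) :
    p.natDegree = Fintype.card ι := by
  rw [← show _ = p from hz, natDegree_finsetProd_X_sub_C_eq_card, Finset.card_univ]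

theorem IsRootVector.nnnorm_lt {p : ℂ[X]} {z : ι → ℂ} (hz : IsRootVector p z) {M : ℝ≥0}
    (hM : ∀ i < Fintype.card ι, ‖p.coeff i‖₊ ≤ M) (j : ι) : ‖z j‖₊ < M + 1 := by
  have hmonic : p.Monic := hz ▸ monic_prod_X_sub_C z Finset.univ
  refine (IsRoot.norm_lt_cauchyBound hmonic.ne_zero (hz.eval_eq_zero_iff.2 ⟨j, rfl⟩)).trans_le ?_
  rw [cauchyBound, hmonic.leadingCoeff, nnnorm_one, div_one]
  gcongr
  exact Finset.sup_le fun i hi => hM i (hz.natDegree_eq ▸ Finset.mem_range.1 hi)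

theorem IsRootVector.of_tendsto {α : Type*} {l : Filter α} [l.NeBot] {p : α → ℂ[X]} {p₀ : ℂ[X]}
    {z : α → ι → ℂ} {z₀ : ι → ℂ} (hp : ∀ x, Tendsto (fun a => (p a).eval x) l (𝓝 (p₀.eval x)))
    (hz : Tendsto z l (𝓝 z₀)) (h : ∀ a, IsRootVector (p a) (z a)) : IsRootVector p₀ z₀ := by
  refine Polynomial.funext fun x => ?_
  have hprod : Tendsto (fun a => ∏ j, (x - z a j)) l (𝓝 (∏ j, (x - z₀ j))) :=
    tendsto_finsetProd _ fun j _ => tendsto_const_nhds.sub (tendsto_pi_nhds.1 hz j)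
  simp only [eval_prod, eval_sub, eval_X, eval_C]
  exact tendsto_nhds_unique (hprod.congr fun a => ((h a).eval_eq_prod x).symm) (hp x)

theorem eventually_exists_dist_comp_perm_lt {T : Type*} [TopologicalSpace T] {p : T → ℂ[X]}
    (hp : ∀ i, Continuous fun t => (p t).coeff i) {z : T → ι → ℂ}
    (hz : ∀ t, IsRootVector (p t) (z t)) (t₀ : T) {ε : ℝ} (hε : 0 < ε) :
    ∀ᶠ t in 𝓝 t₀, ∃ σ : Equiv.Perm ι, dist (z t ∘ σ) (z t₀) < ε := by
  refine mem_iff_ultrafilter.2 fun l hl => ?_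
  let M : ℝ≥0 := (Finset.range (Fintype.card ι)).sup (fun i => ‖(p t₀).coeff i‖₊) + 1
  have hcoeff : ∀ᶠ t in 𝓝 t₀, ∀ i ∈ Finset.range (Fintype.card ι), ‖(p t).coeff i‖₊ < M := by
    refine (Finset.eventually_all _).2 fun i hi => (hp i).nnnorm.continuousAt.eventually_lt_const ?_
    exact (Finset.le_sup (f := fun i => ‖(p t₀).coeff i‖₊) hi).trans_lt (lt_add_one _)
  have hbound : ∀ᶠ t in l, z t ∈ univ.pi fun _ : ι => Metric.closedBall (0 : ℂ) (M + 1 : ℝ≥0) := by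
    filter_upwards [hl hcoeff] with t ht j _
    exact mem_closedBall_zero_iff.2
      ((hz t).nnnorm_lt (fun i hi => (ht i (Finset.mem_range.2 hi)).le) j).le
  obtain ⟨z₀, -, hz₀⟩ := (isCompact_univ_pi fun _ : ι =>
    isCompact_closedBall (0 : ℂ) (M + 1 : ℝ≥0)).ultrafilter_le_nhds' (l.map z) hbound
  have heval (x : ℂ) : Continuous fun t => (p t).eval x := by
    refine (continuous_finsetSum (Finset.range (Fintype.card ι + 1)) fun i _ =>
      (hp i).mul (continuous_const (y := x ^ i))).congr fun t => ?_
    exact (eval_eq_sum_range' (by simp only [(hz t).natDegree_eq, lt_add_one]) x).symm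
  obtain ⟨σ, hσ⟩ := (hz t₀).exists_comp_perm_eq
    (IsRootVector.of_tendsto (fun x => ((heval x).tendsto t₀).mono_left hl) hz₀ hz)
  have hlim : Tendsto (fun t => z t ∘ σ) l (𝓝 (z₀ ∘ σ)) :=
    tendsto_pi_nhds.2 fun j => tendsto_pi_nhds.1 hz₀ (σ j)
  filter_upwards [(hσ ▸ hlim).eventually (Metric.ball_mem_nhds _ hε)] with t ht using ⟨σ, ht⟩

open DomMulAct in
theorem exists_continuousOn_isRootVector {p : ℝ → ℂ[X]} (hmonic : ∀ t, (p t).Monic)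
    (hdeg : ∀ t, (p t).natDegree = Fintype.card ι)
    (hp : ∀ i, Continuous fun t => (p t).coeff i) (T : ℝ) :
    ∃ z : ℝ → ι → ℂ, ContinuousOn z (Icc 0 T) ∧ ∀ t, IsRootVector (p t) (z t) := by
  choose x hx using fun t => exists_isRootVector (hmonic t) (hdeg t)
  have : Finite (Equiv.Perm ι)ᵈᵐᵃ := Finite.of_equiv _ mk
  have : IsIsometricSMul (Equiv.Perm ι)ᵈᵐᵃ (ι → ℂ) :=
    ⟨fun c => (IsometryEquiv.piCongrLeft' (mk.symm c).symm).isometry⟩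
  obtain ⟨g, hg⟩ := exists_continuousOn_smul_Icc (G := (Equiv.Perm ι)ᵈᵐᵃ) (fun t₀ ε hε =>
    (eventually_exists_dist_comp_perm_lt hp hx t₀ hε).mono fun t ⟨σ, hσ⟩ => ⟨mk σ, hσ⟩) T
  exact ⟨_, hg, fun t => (hx t).comp_perm (mk.symm (g t))⟩

end RootVector

section Monodromy

theorem sameCycle_mul_swap {α : Type*} [DecidableEq α] [Finite α] {σ : Equiv.Perm α} {i j : α}
    (hij : ¬σ.SameCycle i j) : (σ * Equiv.swap i j).SameCycle i j := by
  set τ := σ * Equiv.swap i j with hτ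
  have hi : τ.SameCycle i (σ j) := ⟨1, by simp [hτ]⟩
  have hcycle (k : ℕ) : τ.SameCycle i ((σ ^ (k + 1)) j) := by
    induction k with
    | zero => simpa using hi
    | succ k ih =>
      rw [pow_succ', Equiv.Perm.mul_apply]
      rcases eq_or_ne ((σ ^ (k + 1)) j) j with hj | hj
      · rwa [hj]
      · have hne : (σ ^ (k + 1)) j ≠ i := fun h =>
          hij (Equiv.Perm.SameCycle.symm ⟨(k + 1 : ℕ), by rwa [zpow_natCast]⟩)
        have happly : τ ((σ ^ (k + 1)) j) = σ ((σ ^ (k + 1)) j) := by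
          rw [hτ, Equiv.Perm.mul_apply, Equiv.swap_apply_of_ne_of_ne hne hj]
        exact happly ▸ ih.apply_right
  obtain ⟨n, hn⟩ := Nat.exists_eq_add_of_lt (orderOf_pos σ)
  have hlast := hcycle n
  rwa [← zero_add n, ← hn, pow_orderOf_eq_one] at hlast

theorem sameCycle_mul_swap_of_sameCycle {α : Type*} [DecidableEq α] [Finite α]
    {σ : Equiv.Perm α} {i j a b : α} (hij : ¬σ.SameCycle i j) (hab : σ.SameCycle a b) :
    (σ * Equiv.swap i j).SameCycle a b := by
  have hij' := sameCycle_mul_swap hij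
  have hstep (x : α) : (σ * Equiv.swap i j).SameCycle x (σ x) := by
    rcases eq_or_ne x i with rfl | hi
    · exact hij'.trans ⟨1, by simp⟩
    rcases eq_or_ne x j with rfl | hj
    · exact hij'.symm.trans ⟨1, by simp⟩
    · exact ⟨1, by simp [Equiv.swap_apply_of_ne_of_ne hi hj]⟩
  obtain ⟨k, rfl⟩ := hab.exists_nat_pow_eq
  induction k with
  | zero => rfl
  | succ k ih =>
    rw [pow_succ', Equiv.Perm.mul_apply]
    exact (ih ⟨k, rfl⟩).trans (hstep _)

variable {ι X : Type*} [TopologicalSpace X]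

/-- The paths `z · i` on `[0, T]` close up to the permutation `σ` of their end points. -/
structure IsMonodromy (z : ℝ → ι → X) (T : ℝ) (σ : Equiv.Perm ι) : Prop where
  continuousOn : ContinuousOn z (Icc 0 T)
  comp_eq : z 0 ∘ σ = z T

theorem IsMonodromy.exists_mul_swap [DecidableEq ι] {z : ℝ → ι → X} {T : ℝ} {σ : Equiv.Perm ι}
    (h : IsMonodromy z T σ) {t₀ : ℝ} (ht₀ : t₀ ∈ Icc 0 T) {i j : ι} (hij : z t₀ i = z t₀ j) :
    ∃ z' : ℝ → ι → X, IsMonodromy z' T (σ * Equiv.swap i j) ∧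
      ∀ t, ∃ τ : Equiv.Perm ι, z' t = z t ∘ τ := by
  let w : ℝ → ι → X := fun t => z t ∘ Equiv.swap i j
  have hw : z t₀ = w t₀ := by
    funext k
    rcases eq_or_ne k i with rfl | hi
    · simp [w, hij]
    rcases eq_or_ne k j with rfl | hj
    · simp [w, hij]
    · simp [w, Equiv.swap_apply_of_ne_of_ne hi hj]
  let z' : ℝ → ι → X := fun t => if t ≤ t₀ then z t else w t
  have hleft : EqOn z' z (Iic t₀) := fun t ht => if_pos ht
  have hright : EqOn z' w (Ici t₀) := fun t ht => by
    rcases (mem_Ici.1 ht).eq_or_lt with rfl | hlt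
    · exact (hleft self_mem_Iic).trans hw
    · exact if_neg hlt.not_ge
  refine ⟨z', ⟨?_, ?_⟩, fun t => ?_⟩
  · rw [← Icc_union_Icc_eq_Icc ht₀.1 ht₀.2]
    refine ContinuousOn.union_of_isClosed ?_ ?_ isClosed_Icc isClosed_Icc
    · exact (h.continuousOn.mono (Icc_subset_Icc_right ht₀.2)).congr
        (hleft.mono Icc_subset_Iic_self)
    · have hwc : ContinuousOn w (Icc t₀ T) := (Pi.continuous_precomp _).comp_continuousOn
        (h.continuousOn.mono (Icc_subset_Icc_left ht₀.1))
      exact hwc.congr (hright.mono Icc_subset_Ici_self)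
  · rw [hleft ht₀.1, hright ht₀.2, Equiv.Perm.coe_mul, ← Function.comp_assoc, h.comp_eq]
  · by_cases ht : t ≤ t₀
    · exact ⟨1, hleft ht⟩
    · exact ⟨Equiv.swap i j, hright (not_le.1 ht).le⟩

theorem IsMonodromy.exists_sameCycle_of_eq [Finite ι] {z : ℝ → ι → X} {T : ℝ} {σ : Equiv.Perm ι}
    (h : IsMonodromy z T σ) :
    ∃ (z' : ℝ → ι → X) (σ' : Equiv.Perm ι), IsMonodromy z' T σ' ∧
      (∀ t, ∃ τ : Equiv.Perm ι, z' t = z t ∘ τ) ∧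
      ∀ t ∈ Icc 0 T, ∀ i j, z' t i = z' t j → σ'.SameCycle i j := by
  classical
  let S := {σ' : Equiv.Perm ι |
    ∃ z', IsMonodromy z' T σ' ∧ ∀ t, ∃ τ : Equiv.Perm ι, z' t = z t ∘ τ}
  obtain ⟨σ', ⟨z', hz', hτ⟩, hmax⟩ := S.toFinite.exists_maximalFor
    (fun σ' => {p : ι × ι | σ'.SameCycle p.1 p.2}) S ⟨σ, z, h, fun _ => ⟨1, rfl⟩⟩
  refine ⟨z', σ', hz', hτ, fun t ht i j hij => ?_⟩
  by_contra hcon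
  obtain ⟨z'', hz'', hτ'⟩ := hz'.exists_mul_swap ht hij
  have hmem : σ' * Equiv.swap i j ∈ S := by
    refine ⟨z'', hz'', fun t => ?_⟩
    obtain ⟨τ, hτt⟩ := hτ t
    obtain ⟨τ', hτt'⟩ := hτ' t
    exact ⟨τ * τ', by rw [hτt', hτt]; rfl⟩
  exact hcon (hmax hmem (fun p => sameCycle_mul_swap_of_sameCycle hcon)
    (show (i, j) ∈ {p : ι × ι | (σ' * Equiv.swap i j).SameCycle p.1 p.2} from
      sameCycle_mul_swap hcon))

end Monodromy

section CyclePath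

/-- The path `z · i`, continued along the cycle of `i` under `σ`: on `[k T, (k + 1) T]` it runs
through `z · (σ^k i)`. -/
noncomputable def cyclePath {ι X : Type*} (z : ℝ → ι → X) (σ : Equiv.Perm ι) (T : ℝ) (i : ι)
    (t : ℝ) : X :=
  z (t - ⌊t / T⌋₊ * T) (σ^[⌊t / T⌋₊] i)

/-- The points on the paths `z · j`, where `j` runs through the cycle of `i` under `σ`. -/
def cycleTrace {ι X : Type*} (z : ℝ → ι → X) (σ : Equiv.Perm ι) (T : ℝ) (i : ι) : Set X :=
  {x | ∃ s ∈ Ico 0 T, ∃ j, σ.SameCycle i j ∧ z s j = x}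

theorem exists_eq_add_natCast_mul {T t : ℝ} {m : ℕ} (hT : 0 < T) (ht : t ∈ Ico 0 (m * T)) :
    ∃ k < m, ∃ s ∈ Ico 0 T, t = s + k * T := by
  have hdiv : 0 ≤ t / T := div_nonneg ht.1 hT.le
  refine ⟨⌊t / T⌋₊, (Nat.floor_lt hdiv).2 ((div_lt_iff₀ hT).2 ht.2), t - ⌊t / T⌋₊ * T,
    ⟨?_, ?_⟩, by ring⟩
  · rw [sub_nonneg, ← le_div_iff₀ hT]
    exact Nat.floor_le hdiv
  · rw [sub_lt_iff_lt_add', ← add_one_mul, ← div_lt_iff₀ hT]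
    exact Nat.lt_floor_add_one _

theorem add_natCast_mul_mem_Ico {T s : ℝ} {k m : ℕ} (hk : k < m) (hs : s ∈ Ico 0 T) :
    s + k * T ∈ Ico 0 (m * T) := by
  have hT : 0 ≤ T := hs.1.trans hs.2.le
  have hkm : (k + 1 : ℝ) * T ≤ m * T :=
    mul_le_mul_of_nonneg_right (by exact_mod_cast hk) hT
  exact ⟨add_nonneg hs.1 (mul_nonneg k.cast_nonneg hT), by linarith [hs.2]⟩

theorem minimalPeriod_perm_pos {ι : Type*} [Finite ι] (σ : Equiv.Perm ι) (i : ι) :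
    0 < Function.minimalPeriod σ i :=
  Function.minimalPeriod_pos_of_mem_periodicPts (σ.injective.mem_periodicPts i)

variable {ι X : Type*} {z : ℝ → ι → X} {T : ℝ} {σ : Equiv.Perm ι}

theorem cycleTrace_eq_of_sameCycle {i j : ι} (hij : σ.SameCycle i j) :
    cycleTrace z σ T i = cycleTrace z σ T j := by
  ext x
  exact ⟨fun ⟨s, hs, k, hk, hx⟩ => ⟨s, hs, k, hij.symm.trans hk, hx⟩,
    fun ⟨s, hs, k, hk, hx⟩ => ⟨s, hs, k, hij.trans hk, hx⟩⟩

namespace IsMonodromy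

variable [TopologicalSpace X]

theorem cyclePath_add (h : IsMonodromy z T σ) (hT : 0 < T) (i : ι) (k : ℕ) {s : ℝ}
    (hs : s ∈ Icc 0 T) : cyclePath z σ T i (s + k * T) = z s (σ^[k] i) := by
  have hdiv : (s + k * T) / T = s / T + k := by field_simp
  rcases hs.2.lt_or_eq with hsT | rfl
  · have hfloor : ⌊(s + k * T) / T⌋₊ = k := by
      rw [hdiv, Nat.floor_add_natCast (div_nonneg hs.1 hT.le),
        Nat.floor_eq_zero.2 ((div_lt_one hT).2 hsT), zero_add]
    rw [cyclePath, hfloor, add_sub_cancel_right]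
  · have hfloor : ⌊(s + k * s) / s⌋₊ = k + 1 := by
      rw [hdiv, div_self hT.ne', Nat.floor_add_natCast zero_le_one, Nat.floor_one, add_comm]
    have hzero : s + k * s - (k + 1 : ℕ) * s = 0 := by push_cast; ring
    rw [cyclePath, hfloor, hzero, Function.iterate_succ_apply', ← h.comp_eq, Function.comp_apply]

theorem continuousOn_cyclePath (h : IsMonodromy z T σ) (hT : 0 < T) (i : ι) (m : ℕ) :
    ContinuousOn (cyclePath z σ T i) (Icc 0 (m * T)) := by
  induction m with
  | zero => simp
  | succ m ih =>
    have hm : (0 : ℝ) ≤ m * T := by positivity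
    have hsucc : ((m + 1 : ℕ) : ℝ) * T = m * T + T := by push_cast; ring
    rw [hsucc, ← Icc_union_Icc_eq_Icc hm (le_add_of_nonneg_right hT.le)]
    refine ih.union_of_isClosed ?_ isClosed_Icc isClosed_Icc
    have hshift : MapsTo (fun t => t - m * T) (Icc (m * T) (m * T + T)) (Icc 0 T) :=
      fun t ht => ⟨by linarith [ht.1], by linarith [ht.2]⟩
    have hpath : ContinuousOn (fun t => z (t - m * T) (σ^[m] i)) (Icc (m * T) (m * T + T)) :=
      (continuous_apply (σ^[m] i)).comp_continuousOn (h.continuousOn.comp (by fun_prop) hshift)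
    refine hpath.congr fun t ht => ?_
    simpa only [sub_add_cancel] using h.cyclePath_add hT i m (hshift ht)

theorem cyclePath_closed (h : IsMonodromy z T σ) (hT : 0 < T) (i : ι) :
    cyclePath z σ T i 0 = cyclePath z σ T i (Function.minimalPeriod σ i * T) := by
  have hzero := h.cyclePath_add hT i 0 (left_mem_Icc.2 hT.le)
  have hperiod := h.cyclePath_add hT i (Function.minimalPeriod σ i) (left_mem_Icc.2 hT.le)
  rw [Function.iterate_minimalPeriod, zero_add] at hperiod
  rw [Nat.cast_zero, zero_mul, zero_add, Function.iterate_zero, id] at hzero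
  rw [hzero, hperiod]

theorem image_cyclePath_Ico [Finite ι] (h : IsMonodromy z T σ) (hT : 0 < T) (i : ι) :
    cyclePath z σ T i '' Ico 0 (Function.minimalPeriod σ i * T) = cycleTrace z σ T i := by
  ext x
  constructor
  · rintro ⟨t, ht, rfl⟩
    obtain ⟨k, -, s, hs, rfl⟩ := exists_eq_add_natCast_mul hT ht
    refine ⟨s, hs, σ^[k] i, ⟨k, ?_⟩, (h.cyclePath_add hT i k (Ico_subset_Icc_self hs)).symm⟩
    rw [zpow_natCast, Equiv.Perm.iterate_eq_pow]
  · rintro ⟨s, hs, j, hj, rfl⟩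
    obtain ⟨k, hk⟩ := hj.exists_nat_pow_eq
    rw [← Equiv.Perm.iterate_eq_pow, ← Function.iterate_mod_minimalPeriod_eq] at hk
    refine ⟨_, add_natCast_mul_mem_Ico (Nat.mod_lt k (minimalPeriod_perm_pos σ i)) hs, ?_⟩
    rw [h.cyclePath_add hT i _ (Ico_subset_Icc_self hs), hk]

theorem image_cyclePath_Icc [Finite ι] (h : IsMonodromy z T σ) (hT : 0 < T) (i : ι) :
    cyclePath z σ T i '' Icc 0 (Function.minimalPeriod σ i * T) = cycleTrace z σ T i := by
  have hpos : 0 < Function.minimalPeriod σ i * T :=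
    mul_pos (by exact_mod_cast minimalPeriod_perm_pos σ i) hT
  rw [← h.image_cyclePath_Ico hT, ← Ico_insert_right hpos.le, image_insert_eq,
    ← h.cyclePath_closed hT, insert_eq_of_mem]
  exact mem_image_of_mem _ (left_mem_Ico.2 hpos)

theorem isClosed_cycleTrace [Finite ι] [T2Space X] (h : IsMonodromy z T σ) (hT : 0 < T)
    (i : ι) : IsClosed (cycleTrace z σ T i) := by
  rw [← h.image_cyclePath_Icc hT]
  exact (isCompact_Icc.image_of_continuousOn (h.continuousOn_cyclePath hT i _)).isClosed

theorem isPreconnected_cycleTrace [Finite ι] (h : IsMonodromy z T σ) (hT : 0 < T) (i : ι) :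
    IsPreconnected (cycleTrace z σ T i) := by
  rw [← h.image_cyclePath_Icc hT]
  exact isPreconnected_Icc.image _ (h.continuousOn_cyclePath hT i _)

end IsMonodromy

end CyclePath

theorem connectedComponentIn_eq_of_finite_closed_cover {ι X : Type*} [Finite ι]
    [TopologicalSpace X] {L : Set X} {E : ι → Set X} (hclosed : ∀ i, IsClosed (E i))
    (hconn : ∀ i, IsPreconnected (E i)) (hcover : ⋃ i, E i = L)
    (hdisj : ∀ i j, (E i ∩ E j).Nonempty → E i = E j) {i : ι} {x : X} (hx : x ∈ E i) :
    connectedComponentIn L x = E i := by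
  have hEL : E i ⊆ L := hcover ▸ subset_iUnion E i
  refine Subset.antisymm ?_ ((hconn i).subset_connectedComponentIn hx hEL)
  let F : Set X := ⋃ j ∈ {j | E i ≠ E j}, E j
  have hF : IsClosed F := (Set.toFinite _).isClosed_biUnion fun j _ => hclosed j
  have hEF : E i ∩ F = ∅ := by
    refine eq_empty_of_forall_notMem fun y hy => ?_
    obtain ⟨j, hj, hyj⟩ := mem_iUnion₂.1 hy.2
    exact hj (hdisj i j ⟨y, hy.1, hyj⟩)
  have hsub : connectedComponentIn L x ⊆ E i ∪ F := fun y hy => by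
    obtain ⟨j, hj⟩ := mem_iUnion.1 (hcover ▸ connectedComponentIn_subset L x hy)
    by_cases hij : E i = E j
    · exact Or.inl (hij ▸ hj)
    · exact Or.inr (mem_iUnion₂.2 ⟨j, hij, hj⟩)
  refine ((isPreconnected_iff_subset_of_disjoint_closed.1 isPreconnected_connectedComponentIn)
    _ _ (hclosed i) hF hsub (by rw [hEF, inter_empty])).resolve_right fun hcF => ?_
  have hxF : x ∈ E i ∩ F := ⟨hx, hcF (mem_connectedComponentIn (hEL hx))⟩
  rwa [hEF] at hxF

section LeadingCoeff

open Polynomial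

theorem eval_reflect {K : Type*} [Field K] {p : K[X]} {N : ℕ} (hp : p.natDegree ≤ N) {x : K}
    (hx : x ≠ 0) : (p.reflect N).eval x = x ^ N * p.eval x⁻¹ := by
  have hx' : x⁻¹ ≠ 0 := inv_ne_zero hx
  let _ := invertibleOfNonzero hx'
  have h := eval₂_reflect_mul_pow (RingHom.id K) x⁻¹ N p hp
  rw [invOf_eq_inv, inv_inv, eval₂_id, eval₂_id] at h
  rw [← h, mul_comm, mul_assoc, ← mul_pow, inv_mul_cancel₀ hx, one_pow, mul_one]

theorem eval_zero_reflect {R : Type*} [Semiring R] (p : R[X]) (N : ℕ) :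
    (p.reflect N).eval 0 = p.coeff N := by
  rw [← coeff_zero_eq_eval_zero, coeff_reflect, revAt_le N.zero_le, Nat.sub_zero]

theorem norm_lt_of_eventually_norm_lt {w : ℂ → ℂ} {a : ℂ} {r : ℝ}
    (hw : ∀ᶠ z in 𝓝 a, DifferentiableAt ℂ w z) (h : ∀ᶠ z in 𝓝[≠] a, ‖w z‖ < r) :
    ‖w a‖ < r := by
  by_contra! hle
  have hmax : IsLocalMax (norm ∘ w) a := by
    filter_upwards [eventually_nhdsWithin_iff.1 h] with z hz
    rcases eq_or_ne z a with rfl | hza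
    · exact le_rfl
    · exact (hz hza).le.trans hle
  have hconst := Complex.eventually_eq_of_isLocalMax_norm hw hmax
  obtain ⟨z, hz, hza⟩ := (h.and (hconst.filter_mono nhdsWithin_le_nhds)).exists
  exact (hza ▸ hz).not_ge hle

variable {u v : ℂ[X]}

theorem eventually_norm_eval_reflect_lt
    (h : ∀ᶠ z in Bornology.cobounded ℂ, ‖u.eval z‖ < ‖v.eval z‖) {N : ℕ}
    (hu : u.natDegree ≤ N) (hv : v.natDegree ≤ N) :
    ∀ᶠ z in 𝓝[≠] 0, ‖(u.reflect N).eval z‖ < ‖(v.reflect N).eval z‖ := by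
  filter_upwards [tendsto_inv₀_nhdsNE_zero.eventually h, self_mem_nhdsWithin] with z hz hz0
  rw [eval_reflect hu hz0, eval_reflect hv hz0, norm_mul, norm_mul]
  exact mul_lt_mul_of_pos_left hz (norm_pos_iff.2 (pow_ne_zero _ hz0))

theorem norm_coeff_le_of_eventually_norm_lt
    (h : ∀ᶠ z in Bornology.cobounded ℂ, ‖u.eval z‖ < ‖v.eval z‖) {N : ℕ}
    (hu : u.natDegree ≤ N) (hv : v.natDegree ≤ N) : ‖u.coeff N‖ ≤ ‖v.coeff N‖ := by
  have hlim (p : ℂ[X]) :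
      Tendsto (fun z => ‖(p.reflect N).eval z‖) (𝓝[≠] 0) (𝓝 ‖p.coeff N‖) := by
    rw [← eval_zero_reflect]
    exact ((p.reflect N).continuous.norm.tendsto 0).mono_left nhdsWithin_le_nhds
  exact le_of_tendsto_of_tendsto (hlim u) (hlim v)
    ((eventually_norm_eval_reflect_lt h hu hv).mono fun _ => le_of_lt)

theorem natDegree_le_of_eventually_norm_lt
    (h : ∀ᶠ z in Bornology.cobounded ℂ, ‖u.eval z‖ < ‖v.eval z‖) :
    u.natDegree ≤ v.natDegree := by
  by_contra! hlt
  have hle := norm_coeff_le_of_eventually_norm_lt h le_rfl hlt.le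
  rw [coeff_eq_zero_of_natDegree_lt hlt, norm_zero, norm_le_zero_iff, coeff_natDegree,
    leadingCoeff_eq_zero] at hle
  simp [hle] at hlt

theorem norm_coeff_lt_of_eventually_norm_lt
    (h : ∀ᶠ z in Bornology.cobounded ℂ, ‖u.eval z‖ < ‖v.eval z‖) :
    ‖u.coeff v.natDegree‖ < ‖v.leadingCoeff‖ := by
  let N := v.natDegree
  have hv : v ≠ 0 := by
    rintro rfl
    obtain ⟨z, hz⟩ := h.exists
    exact (norm_nonneg _).not_gt (by simpa using hz)
  have hlead : (v.reflect N).eval 0 ≠ 0 := by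
    rw [eval_zero_reflect]
    exact leadingCoeff_ne_zero.2 hv
  have hne : ∀ᶠ z in 𝓝 0, (v.reflect N).eval z ≠ 0 :=
    (v.reflect N).continuous.continuousAt.eventually_ne hlead
  have hlt : ‖(u.reflect N).eval 0 / (v.reflect N).eval 0‖ < 1 := by
    refine norm_lt_of_eventually_norm_lt (w := fun z => (u.reflect N).eval z / (v.reflect N).eval z)
      (hne.mono fun z hz =>
        (u.reflect N).differentiableAt.div (v.reflect N).differentiableAt hz) ?_
    filter_upwards [hne.filter_mono nhdsWithin_le_nhds, eventually_norm_eval_reflect_lt h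
      (natDegree_le_of_eventually_norm_lt h) le_rfl] with z hz hlt
    rwa [norm_div, div_lt_one (norm_pos_iff.2 hz)]
  rwa [norm_div, div_lt_one (norm_pos_iff.2 hlead), eval_zero_reflect, eval_zero_reflect] at hlt

end LeadingCoeff

section LevelPoly

open Polynomial

/-- The monic polynomial with the zeros of `u - e^{it} v`, provided `|u / v| < 1` at infinity. -/
noncomputable def levelPoly (u v : ℂ[X]) (t : ℝ) : ℂ[X] :=
  C (u.coeff v.natDegree - Complex.exp (t * Complex.I) * v.leadingCoeff)⁻¹ *
    (u - C (Complex.exp (t * Complex.I)) * v)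

theorem sub_exp_mul_ne_zero {p q : ℂ} (h : ‖p‖ ≠ ‖q‖) (t : ℝ) :
    p - Complex.exp (t * Complex.I) * q ≠ 0 := by
  rw [sub_ne_zero]
  rintro rfl
  rw [norm_mul, Complex.norm_exp_ofReal_mul_I, one_mul] at h
  exact h rfl

variable {u v : ℂ[X]}

theorem levelPoly_two_pi : levelPoly u v (2 * Real.pi) = levelPoly u v 0 := by
  simp [levelPoly]

theorem eval_levelPoly (t : ℝ) (x : ℂ) : (levelPoly u v t).eval x =
    (u.eval x - Complex.exp (t * Complex.I) * v.eval x) /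
      (u.coeff v.natDegree - Complex.exp (t * Complex.I) * v.leadingCoeff) := by
  rw [levelPoly, eval_mul, eval_C, eval_sub, eval_mul, eval_C, inv_mul_eq_div]

variable (hinf : ∀ᶠ z in Bornology.cobounded ℂ, ‖u.eval z‖ < ‖v.eval z‖)
include hinf

theorem eval_levelPoly_eq_zero_iff (t : ℝ) (x : ℂ) :
    (levelPoly u v t).eval x = 0 ↔ u.eval x = Complex.exp (t * Complex.I) * v.eval x := by
  rw [eval_levelPoly, div_eq_zero_iff, sub_eq_zero,
    or_iff_left (sub_exp_mul_ne_zero (norm_coeff_lt_of_eventually_norm_lt hinf).ne t)]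

theorem coeff_natDegree_levelPoly (t : ℝ) : (levelPoly u v t).coeff v.natDegree = 1 := by
  rw [levelPoly, coeff_C_mul, coeff_sub, coeff_C_mul]
  exact inv_mul_cancel₀ (sub_exp_mul_ne_zero (norm_coeff_lt_of_eventually_norm_lt hinf).ne t)

theorem natDegree_levelPoly (t : ℝ) : (levelPoly u v t).natDegree = v.natDegree := by
  refine natDegree_eq_of_le_of_coeff_ne_zero ?_
    (by rw [coeff_natDegree_levelPoly hinf]; exact one_ne_zero)
  refine (natDegree_C_mul_le _ _).trans ((natDegree_sub_le _ _).trans ?_)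
  exact max_le (natDegree_le_of_eventually_norm_lt hinf) (natDegree_C_mul_le _ _)

theorem monic_levelPoly (t : ℝ) : (levelPoly u v t).Monic := by
  rw [Monic, leadingCoeff, natDegree_levelPoly hinf, coeff_natDegree_levelPoly hinf]

theorem continuous_coeff_levelPoly (i : ℕ) : Continuous fun t => (levelPoly u v t).coeff i := by
  simp only [levelPoly, coeff_C_mul, coeff_sub]
  exact (Continuous.inv₀ (by fun_prop)
    (sub_exp_mul_ne_zero (norm_coeff_lt_of_eventually_norm_lt hinf).ne)).mul (by fun_prop)

theorem derivative_levelPoly_ne_zero {t : ℝ} {x : ℂ} (hx : (levelPoly u v t).eval x = 0)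
    (hw : (wronskian u v).eval x ≠ 0) : (levelPoly u v t).derivative.eval x ≠ 0 := by
  contrapose! hw
  rw [levelPoly, derivative_C_mul, eval_mul, eval_C, derivative_sub, derivative_C_mul, eval_sub,
    eval_mul, eval_C] at hw
  have hderiv : u.derivative.eval x = Complex.exp (t * Complex.I) * v.derivative.eval x :=
    sub_eq_zero.1 ((mul_eq_zero.1 hw).resolve_left
      (inv_ne_zero (sub_exp_mul_ne_zero (norm_coeff_lt_of_eventually_norm_lt hinf).ne t)))
  rw [wronskian, eval_sub, eval_mul, eval_mul, hderiv,
    (eval_levelPoly_eq_zero_iff hinf t x).1 hx]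
  ring

theorem IsRootVector.eq_of_wronskian_ne_zero {ι : Type*} [Fintype ι] {t : ℝ} {z : ι → ℂ}
    (hz : IsRootVector (levelPoly u v t) z) {i j : ι} (hij : z i = z j)
    (hw : (wronskian u v).eval (z i) ≠ 0) : i = j :=
  hz.eq_of_derivative_ne_zero hij
    (derivative_levelPoly_ne_zero hinf (hz.eval_eq_zero_iff.2 ⟨i, rfl⟩) hw)

end LevelPoly

theorem eq_of_exp_mul_I_eq {s t : ℝ} (hs : s ∈ Ico 0 (2 * Real.pi))
    (ht : t ∈ Ico 0 (2 * Real.pi))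
    (h : Complex.exp (s * Complex.I) = Complex.exp (t * Complex.I)) : s = t :=
  Circle.exp_injOn_Ico (sub_zero (2 * Real.pi)).le hs ht
    (Circle.ext (by simpa only [Circle.coe_exp] using h))

theorem exists_exp_mul_I_eq {w : ℂ} (hw : ‖w‖ = 1) :
    ∃ t ∈ Ico 0 (2 * Real.pi), Complex.exp (t * Complex.I) = w := by
  obtain ⟨θ, rfl⟩ := (Complex.norm_eq_one_iff w).1 hw
  obtain ⟨t, ht, hθ⟩ := Circle.periodic_exp.exists_mem_Ico₀ Real.two_pi_pos θ
  refine ⟨t, ht, ?_⟩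
  rw [← Circle.coe_exp, ← Circle.coe_exp, hθ]

theorem exp_add_natCast_mul (s : ℝ) (k : ℕ) :
    Complex.exp (((s + k * (2 * Real.pi) : ℝ) : ℂ) * Complex.I) =
      Complex.exp (s * Complex.I) := by
  rw [← Circle.coe_exp, ← Circle.coe_exp, Circle.periodic_exp.nat_mul]

section LevelSet

open Polynomial

/-- The level set `|u / v| = 1` of the rational function `u / v`. -/
def levelSet (u v : ℂ[X]) : Set ℂ :=
  {z | ‖u.eval z‖ = ‖v.eval z‖}

/-- The connected components of `|u / v| = 1`. -/
def levelComponents (u v : ℂ[X]) : Set (Set ℂ) :=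
  {Γ | ∃ z ∈ levelSet u v, Γ = connectedComponentIn (levelSet u v) z}

/-- The analogue of `IsCriticalCurve` for the rational function `u / v` in place of the
dilatation. The Wronskian stands for the derivative of `u / v`. -/
structure IsLevelCurve (u v : ℂ[X]) (Γ : Set ℂ) (γ : Curve) : Prop where
  closed : γ.toFun γ.a = γ.toFun γ.b
  trace : γ.toFun '' Icc γ.a γ.b = Γ
  eval_eq : ∀ t ∈ Icc γ.a γ.b,
    u.eval (γ.toFun t) = Complex.exp (t * Complex.I) * v.eval (γ.toFun t)
  once : ∀ z ∈ Γ, (wronskian u v).eval z ≠ 0 → ∃! t, t ∈ Ico γ.a γ.b ∧ γ.toFun t = z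

/-- The roots of `levelPoly u v t`, followed continuously over one period, together with their
monodromy `σ`, such that roots which meet belong to the same cycle of `σ`. -/
structure IsLevelMonodromy {ι : Type*} [Fintype ι] (u v : ℂ[X]) (z : ℝ → ι → ℂ)
    (σ : Equiv.Perm ι) : Prop extends IsMonodromy z (2 * Real.pi) σ where
  isRootVector : ∀ t, IsRootVector (levelPoly u v t) (z t)
  sameCycle : ∀ t ∈ Icc 0 (2 * Real.pi), ∀ i j, z t i = z t j → σ.SameCycle i j

variable {u v : ℂ[X]}

theorem mem_levelSet_of_eval_eq {t : ℝ} {x : ℂ}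
    (h : u.eval x = Complex.exp (t * Complex.I) * v.eval x) : x ∈ levelSet u v := by
  rw [levelSet, mem_ofPred, h, norm_mul, Complex.norm_exp_ofReal_mul_I, one_mul]

theorem eval_right_ne_zero (hcop : IsCoprime u v) {x : ℂ} (hx : x ∈ levelSet u v) :
    v.eval x ≠ 0 := by
  intro hv
  have hu : u.eval x = 0 := by rw [← norm_eq_zero, show ‖_‖ = ‖_‖ from hx, hv, norm_zero]
  exact (aeval_ne_zero_of_isCoprime hcop x).elim (· hu) (· hv)

theorem eq_of_eval_eq (hcop : IsCoprime u v) {s t : ℝ} {x : ℂ}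
    (hs : s ∈ Ico 0 (2 * Real.pi)) (ht : t ∈ Ico 0 (2 * Real.pi))
    (hxs : u.eval x = Complex.exp (s * Complex.I) * v.eval x)
    (hxt : u.eval x = Complex.exp (t * Complex.I) * v.eval x) : s = t :=
  eq_of_exp_mul_I_eq hs ht (mul_right_cancel₀
    (eval_right_ne_zero hcop (mem_levelSet_of_eval_eq hxs)) (hxs.symm.trans hxt))

theorem exists_eval_eq (hcop : IsCoprime u v) {x : ℂ} (hx : x ∈ levelSet u v) :
    ∃ t ∈ Ico 0 (2 * Real.pi), u.eval x = Complex.exp (t * Complex.I) * v.eval x := by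
  have hv := eval_right_ne_zero hcop hx
  obtain ⟨t, ht, hexp⟩ := exists_exp_mul_I_eq (w := u.eval x / v.eval x) (by
    rw [norm_div, show ‖_‖ = ‖_‖ from hx, div_self (norm_ne_zero_iff.2 hv)])
  exact ⟨t, ht, by rw [hexp, div_mul_cancel₀ _ hv]⟩

theorem exists_isLevelMonodromy
    (hinf : ∀ᶠ z in Bornology.cobounded ℂ, ‖u.eval z‖ < ‖v.eval z‖) :
    ∃ (z : ℝ → Fin v.natDegree → ℂ) (σ : Equiv.Perm (Fin v.natDegree)),
      IsLevelMonodromy u v z σ := by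
  obtain ⟨z, hzc, hz⟩ := exists_continuousOn_isRootVector (ι := Fin v.natDegree)
    (monic_levelPoly hinf) (fun t => by rw [natDegree_levelPoly hinf, Fintype.card_fin])
    (continuous_coeff_levelPoly hinf) (2 * Real.pi)
  obtain ⟨σ, hσ⟩ := (levelPoly_two_pi (u := u) (v := v) ▸ hz (2 * Real.pi)).exists_comp_perm_eq
    (hz 0)
  obtain ⟨z', σ', h, hτ, hsame⟩ := (IsMonodromy.mk hzc hσ).exists_sameCycle_of_eq
  refine ⟨z', σ', h, fun t => ?_, hsame⟩
  obtain ⟨τ, hτt⟩ := hτ t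
  exact hτt ▸ (hz t).comp_perm τ

namespace IsLevelMonodromy

variable {ι : Type*} [Fintype ι] {z : ℝ → ι → ℂ} {σ : Equiv.Perm ι}

theorem eval_eq (h : IsLevelMonodromy u v z σ)
    (hinf : ∀ᶠ z in Bornology.cobounded ℂ, ‖u.eval z‖ < ‖v.eval z‖) (t : ℝ) (j : ι) :
    u.eval (z t j) = Complex.exp (t * Complex.I) * v.eval (z t j) :=
  (eval_levelPoly_eq_zero_iff hinf t _).1 ((h.isRootVector t).eval_eq_zero_iff.2 ⟨j, rfl⟩)

variable (h : IsLevelMonodromy u v z σ) (hcop : IsCoprime u v)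
  (hinf : ∀ᶠ z in Bornology.cobounded ℂ, ‖u.eval z‖ < ‖v.eval z‖)
include h hcop hinf

theorem iUnion_cycleTrace :
    ⋃ i, cycleTrace z σ (2 * Real.pi) i = levelSet u v := by
  ext x
  rw [mem_iUnion]
  constructor
  · rintro ⟨i, s, -, j, -, rfl⟩
    exact mem_levelSet_of_eval_eq (h.eval_eq hinf s j)
  · intro hx
    obtain ⟨t, ht, hxt⟩ := exists_eval_eq hcop hx
    obtain ⟨j, hj⟩ := (h.isRootVector t).eval_eq_zero_iff.1
      ((eval_levelPoly_eq_zero_iff hinf t x).2 hxt)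
    exact ⟨j, t, ht, j, .refl σ j, hj⟩

theorem cycleTrace_eq_of_inter_nonempty {i j : ι} (hij : (cycleTrace z σ (2 * Real.pi) i ∩
    cycleTrace z σ (2 * Real.pi) j).Nonempty) :
    cycleTrace z σ (2 * Real.pi) i = cycleTrace z σ (2 * Real.pi) j := by
  obtain ⟨x, ⟨s, hs, i', hi', rfl⟩, ⟨t, ht, j', hj', hx⟩⟩ := hij
  obtain rfl : t = s := eq_of_eval_eq hcop ht hs (hx ▸ h.eval_eq hinf t j') (h.eval_eq hinf s i')
  exact cycleTrace_eq_of_sameCycle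
    (hi'.trans ((h.sameCycle t (Ico_subset_Icc_self ht) _ _ hx.symm).trans hj'.symm))

theorem connectedComponentIn_levelSet {i : ι} {x : ℂ} (hx : x ∈ cycleTrace z σ (2 * Real.pi) i) :
    connectedComponentIn (levelSet u v) x = cycleTrace z σ (2 * Real.pi) i :=
  connectedComponentIn_eq_of_finite_closed_cover (h.isClosed_cycleTrace Real.two_pi_pos)
    (h.isPreconnected_cycleTrace Real.two_pi_pos) (h.iUnion_cycleTrace hcop hinf)
    (fun _ _ => h.cycleTrace_eq_of_inter_nonempty hcop hinf) hx

theorem exists_eq_cycleTrace {Γ : Set ℂ} (hΓ : Γ ∈ levelComponents u v) :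
    ∃ i, Γ = cycleTrace z σ (2 * Real.pi) i := by
  obtain ⟨x, hx, rfl⟩ := hΓ
  rw [← h.iUnion_cycleTrace hcop hinf, mem_iUnion] at hx
  exact hx.imp fun i => h.connectedComponentIn_levelSet hcop hinf

omit hcop in
theorem eval_cyclePath_eq (i : ι) {m : ℕ} {t : ℝ} (ht : t ∈ Icc 0 (m * (2 * Real.pi))) :
    u.eval (cyclePath z σ (2 * Real.pi) i t) =
      Complex.exp (t * Complex.I) * v.eval (cyclePath z σ (2 * Real.pi) i t) := by
  have ht' : t ∈ Ico 0 ((m + 1 : ℕ) * (2 * Real.pi)) :=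
    ⟨ht.1, ht.2.trans_lt (by push_cast; linarith [Real.two_pi_pos])⟩
  obtain ⟨k, -, s, hs, rfl⟩ := exists_eq_add_natCast_mul Real.two_pi_pos ht'
  rw [h.cyclePath_add Real.two_pi_pos i k (Ico_subset_Icc_self hs), exp_add_natCast_mul]
  exact h.eval_eq hinf s _

theorem eq_of_cyclePath_eq {i : ι} {t t' : ℝ}
    (ht : t ∈ Ico 0 (Function.minimalPeriod σ i * (2 * Real.pi)))
    (ht' : t' ∈ Ico 0 (Function.minimalPeriod σ i * (2 * Real.pi)))
    (heq : cyclePath z σ (2 * Real.pi) i t = cyclePath z σ (2 * Real.pi) i t')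
    (hw : (wronskian u v).eval (cyclePath z σ (2 * Real.pi) i t) ≠ 0) : t = t' := by
  obtain ⟨k, hk, s, hs, rfl⟩ := exists_eq_add_natCast_mul Real.two_pi_pos ht
  obtain ⟨k', hk', s', hs', rfl⟩ := exists_eq_add_natCast_mul Real.two_pi_pos ht'
  rw [h.cyclePath_add Real.two_pi_pos i k (Ico_subset_Icc_self hs)] at heq hw
  rw [h.cyclePath_add Real.two_pi_pos i k' (Ico_subset_Icc_self hs')] at heq
  obtain rfl : s = s' :=
    eq_of_eval_eq hcop hs hs' (h.eval_eq hinf s _) (heq ▸ h.eval_eq hinf s' _)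
  rw [Function.iterate_injOn_Iio_minimalPeriod hk hk'
    ((h.isRootVector s).eq_of_wronskian_ne_zero hinf heq hw)]

theorem isLevelCurve_cyclePath (i : ι)
    (hm : 0 < Function.minimalPeriod σ i * (2 * Real.pi)) :
    IsLevelCurve u v (cycleTrace z σ (2 * Real.pi) i)
      ⟨0, _, hm, cyclePath z σ (2 * Real.pi) i, h.continuousOn_cyclePath Real.two_pi_pos i _⟩ where
  closed := h.cyclePath_closed Real.two_pi_pos i
  trace := h.image_cyclePath_Icc Real.two_pi_pos i
  eval_eq _ ht := h.eval_cyclePath_eq hinf i ht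
  once x hx hw := by
    rw [← h.image_cyclePath_Ico Real.two_pi_pos] at hx
    obtain ⟨t, ht, rfl⟩ := hx
    exact ⟨t, ⟨ht, rfl⟩, fun t' ht' =>
      (h.eq_of_cyclePath_eq hcop hinf ht ht'.1 ht'.2.symm hw).symm⟩

end IsLevelMonodromy

theorem finite_levelComponents (hcop : IsCoprime u v)
    (hinf : ∀ᶠ z in Bornology.cobounded ℂ, ‖u.eval z‖ < ‖v.eval z‖) :
    (levelComponents u v).Finite := by
  obtain ⟨z, σ, h⟩ := exists_isLevelMonodromy hinf
  refine (finite_range (cycleTrace z σ (2 * Real.pi))).subset fun Γ hΓ => ?_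
  obtain ⟨i, rfl⟩ := h.exists_eq_cycleTrace hcop hinf hΓ
  exact mem_range_self i

theorem exists_isLevelCurve (hcop : IsCoprime u v)
    (hinf : ∀ᶠ z in Bornology.cobounded ℂ, ‖u.eval z‖ < ‖v.eval z‖) {Γ : Set ℂ}
    (hΓ : Γ ∈ levelComponents u v) : ∃ γ, IsLevelCurve u v Γ γ := by
  obtain ⟨z, σ, h⟩ := exists_isLevelMonodromy hinf
  obtain ⟨i, rfl⟩ := h.exists_eq_cycleTrace hcop hinf hΓ
  exact ⟨_, h.isLevelCurve_cyclePath hcop hinf i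
    (mul_pos (by exact_mod_cast minimalPeriod_perm_pos σ i) Real.two_pi_pos)⟩

end LevelSet

theorem exists_int_of_exp_mul_I_eq {s t : ℝ}
    (h : Complex.exp (s * Complex.I) = Complex.exp (t * Complex.I)) :
    ∃ n : ℤ, s = t + n * (2 * Real.pi) :=
  Circle.exp_eq_exp.1 (Circle.ext (by simpa only [Circle.coe_exp] using h))

theorem exp_add_intCast_mul (s : ℝ) (n : ℤ) :
    Complex.exp (((s + n * (2 * Real.pi) : ℝ) : ℂ) * Complex.I) = Complex.exp (s * Complex.I) := by
  rw [← Circle.coe_exp, ← Circle.coe_exp, Circle.exp_eq_exp.2 ⟨n, rfl⟩]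

theorem countable_setOf_exp_mul_I_eq (w : ℂ) :
    {t : ℝ | Complex.exp (t * Complex.I) = w}.Countable := by
  rcases eq_empty_or_nonempty {t : ℝ | Complex.exp (t * Complex.I) = w} with h | ⟨t₀, ht₀⟩
  · exact h ▸ countable_empty
  · refine (countable_range fun n : ℤ => t₀ + n * (2 * Real.pi)).mono fun t ht => ?_
    obtain ⟨n, hn⟩ := exists_int_of_exp_mul_I_eq (ht.trans ht₀.symm)
    exact ⟨n, hn.symm⟩

theorem exists_mem_Ico_eq_add_intCast_mul {T : ℝ} (hT : 0 < T) (a t : ℝ) :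
    ∃ s ∈ Ico a (a + T), ∃ n : ℤ, t = s + n * T :=
  ⟨toIcoMod hT a t, toIcoMod_mem_Ico hT a t, toIcoDiv hT a t, by
    rw [← zsmul_eq_mul, toIcoMod_add_toIcoDiv_zsmul]⟩

theorem exists_natCast_eq_add_intCast_mul {m : ℕ} (hm : 0 < m) (n : ℤ) :
    ∃ k < m, ∃ l : ℤ, (k : ℤ) = n + l * m := by
  have hm0 : (0 : ℤ) < m := by exact_mod_cast hm
  have hlt := Int.emod_lt_of_pos n hm0
  have hnn := Int.emod_nonneg n hm0.ne'
  exact ⟨(n % m).toNat, by omega, -(n / m), by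
    rw [Int.toNat_of_nonneg hnn, Int.emod_def]; ring⟩

theorem Curve.exists_periodic_extension (γ : Curve) (h : γ.toFun γ.a = γ.toFun γ.b) :
    ∃ c : ℝ → ℂ, Continuous c ∧ EqOn c γ.toFun (Icc γ.a γ.b) ∧
      Function.Periodic c (γ.b - γ.a) := by
  have : Fact (0 < γ.b - γ.a) := ⟨sub_pos.2 γ.a_lt_b⟩
  have hb : γ.a + (γ.b - γ.a) = γ.b := add_sub_cancel _ _
  let c : ℝ → ℂ := fun t => AddCircle.liftIco (γ.b - γ.a) γ.a γ.toFun (t : AddCircle (γ.b - γ.a))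
  have hper : Function.Periodic c (γ.b - γ.a) := fun t => by simp [c]
  have hIco : ∀ t ∈ Ico γ.a γ.b, c t = γ.toFun t := fun t ht =>
    AddCircle.liftIco_coe_apply (by rwa [hb])
  refine ⟨c, ?_, fun t ht => ?_, hper⟩
  · exact (AddCircle.liftIco_continuous (by rwa [hb]) (by rw [hb]; exact γ.continuousOn)).comp
      (AddCircle.continuous_mk' _)
  · rcases ht.2.lt_or_eq with h1 | h1
    · exact hIco t ⟨ht.1, h1⟩
    · rw [h1, ← h, ← hIco γ.a ⟨le_rfl, γ.a_lt_b⟩, ← hper γ.a, hb]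

section TotalWinding

open Polynomial

/-- `c` is the periodic extension of a level curve with trace `Γ` on which `t` runs through an
interval of length `2πm`. -/
structure IsPeriodicLevelCurve (u v : ℂ[X]) (Γ : Set ℂ) (m : ℕ) (c : ℝ → ℂ) : Prop where
  pos : 0 < m
  continuous : Continuous c
  periodic : Function.Periodic c (m * (2 * Real.pi))
  eval_eq : ∀ t, u.eval (c t) = Complex.exp (t * Complex.I) * v.eval (c t)
  range_eq : range c = Γ
  exists_int : ∀ s t, c s = c t → (wronskian u v).eval (c s) ≠ 0 →
    ∃ n : ℤ, s = t + n * (m * (2 * Real.pi))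

/-- The total winding about `x` of the curves parametrizing the level set `|u / v| = 1`. -/
noncomputable def levelWinding (u v : ℂ[X]) (x : ℂ) : ℝ :=
  if ‖u.eval x‖ < ‖v.eval x‖ then 0 else -1

variable {u v : ℂ[X]}

theorem IsLevelCurve.exists_period {Γ : Set ℂ} {γ : Curve} (h : IsLevelCurve u v Γ γ)
    (hcop : IsCoprime u v) : ∃ m : ℕ, 0 < m ∧ γ.b = γ.a + m * (2 * Real.pi) := by
  have ha := h.eval_eq _ (left_mem_Icc.2 γ.a_lt_b.le)
  have hb := h.eval_eq _ (right_mem_Icc.2 γ.a_lt_b.le)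
  rw [← h.closed] at hb
  obtain ⟨n, hn⟩ := exists_int_of_exp_mul_I_eq (mul_right_cancel₀
    (eval_right_ne_zero hcop (mem_levelSet_of_eval_eq ha)) (hb.symm.trans ha))
  have hn0 : 0 < n := by
    have hpos : 0 < n * (2 * Real.pi) := by linarith [γ.a_lt_b]
    exact_mod_cast pos_of_mul_pos_left hpos Real.two_pi_pos.le
  lift n to ℕ using hn0.le
  exact ⟨n, by exact_mod_cast hn0, hn⟩

theorem IsLevelCurve.exists_isPeriodicLevelCurve {Γ : Set ℂ} {γ : Curve}
    (h : IsLevelCurve u v Γ γ) (hcop : IsCoprime u v) :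
    ∃ (m : ℕ) (c : ℝ → ℂ), IsPeriodicLevelCurve u v Γ m c ∧
      γ.b = γ.a + m * (2 * Real.pi) ∧ EqOn c γ.toFun (Icc γ.a γ.b) := by
  obtain ⟨m, hm, hb⟩ := h.exists_period hcop
  obtain ⟨c, hc, heq, hper⟩ := γ.exists_periodic_extension h.closed
  rw [show γ.b - γ.a = m * (2 * Real.pi) by linarith] at hper
  have hrep : ∀ t, ∃ s ∈ Ico γ.a γ.b, ∃ n : ℤ, t = s + n * (m * (2 * Real.pi)) := by
    rw [hb]
    exact exists_mem_Ico_eq_add_intCast_mul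
      (mul_pos (Nat.cast_pos.2 hm) Real.two_pi_pos) γ.a
  have hcval : ∀ s ∈ Ico γ.a γ.b, ∀ n : ℤ, c (s + n * (m * (2 * Real.pi))) = γ.toFun s :=
    fun s hs n => (hper.int_mul n s).trans (heq (Ico_subset_Icc_self hs))
  refine ⟨m, c, ⟨hm, hc, hper, fun t => ?_, ?_, fun s t hst hw => ?_⟩, hb, heq⟩
  · obtain ⟨s, hs, n, rfl⟩ := hrep t
    have hexp := exp_add_intCast_mul s (n * m)
    push_cast at hexp ⊢
    rw [hcval s hs, h.eval_eq s (Ico_subset_Icc_self hs), ← hexp, mul_assoc (n : ℂ)]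
  · rw [← h.trace]
    refine (range_subset_iff.2 fun t => ?_).antisymm ?_
    · obtain ⟨s, hs, n, rfl⟩ := hrep t
      exact ⟨s, Ico_subset_Icc_self hs, (hcval s hs n).symm⟩
    · rintro _ ⟨t, ht, rfl⟩
      exact ⟨t, heq ht⟩
  · obtain ⟨s', hs', n, rfl⟩ := hrep s
    obtain ⟨t', ht', n', rfl⟩ := hrep t
    rw [hcval s' hs'] at hst hw
    rw [hcval t' ht'] at hst
    have hΓ : γ.toFun s' ∈ Γ := h.trace ▸ mem_image_of_mem _ (Ico_subset_Icc_self hs')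
    obtain rfl := (h.once _ hΓ hw).unique ⟨hs', rfl⟩ ⟨ht', hst.symm⟩
    exact ⟨n - n', by push_cast; ring⟩

theorem dense_setOf_wronskian_ne_zero (hcop : IsCoprime u v)
    (hinf : ∀ᶠ z in Bornology.cobounded ℂ, ‖u.eval z‖ < ‖v.eval z‖) :
    Dense {t : ℝ | ∀ z, u.eval z = Complex.exp (t * Complex.I) * v.eval z →
      (wronskian u v).eval z ≠ 0} := by
  by_cases hW : wronskian u v = 0
  · obtain ⟨hu, hv⟩ := hcop.wronskian_eq_zero_iff.1 hW
    obtain ⟨a, rfl⟩ := natDegree_eq_zero.1 (derivative_eq_zero.1 hu)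
    obtain ⟨b, rfl⟩ := natDegree_eq_zero.1 (derivative_eq_zero.1 hv)
    obtain ⟨y, hy⟩ := hinf.exists
    rw [eval_C, eval_C] at hy
    refine dense_univ.mono fun t _ z hz => absurd (mem_levelSet_of_eval_eq hz) ?_
    simpa only [levelSet, mem_ofPred, eval_C] using hy.ne
  · have hc : (⋃ z ∈ {z | (wronskian u v).IsRoot z},
        {t : ℝ | Complex.exp (t * Complex.I) = u.eval z / v.eval z}).Countable :=
      (finite_setOfPred_isRoot hW).countable.biUnion fun z _ => countable_setOf_exp_mul_I_eq _
    refine (hc.dense_compl ℝ).mono fun t ht z hz hw => ?_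
    exact ht (mem_iUnion₂.2 ⟨z, hw, (eq_div_iff
      (eval_right_ne_zero hcop (mem_levelSet_of_eval_eq hz))).2 hz.symm⟩)

theorem argChange_levelPoly (hinf : ∀ᶠ z in Bornology.cobounded ℂ, ‖u.eval z‖ < ‖v.eval z‖)
    {x : ℂ} (hx : x ∉ levelSet u v) :
    argChange (fun t => (levelPoly u v t).eval x) 0 (2 * Real.pi) = levelWinding u v x := by
  have hlead := norm_coeff_lt_of_eventually_norm_lt hinf
  simp only [eval_levelPoly, div_eq_mul_inv, ← zpow_neg_one]
  rw [argChange_mul Real.two_pi_pos.le (by fun_prop) (fun t _ => sub_exp_mul_ne_zero hx t)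
      ((by fun_prop : ContinuousOn _ _).zpow₀ _ fun t _ =>
        Or.inl (sub_exp_mul_ne_zero hlead.ne t))
      (fun t _ => zpow_ne_zero _ (sub_exp_mul_ne_zero hlead.ne t)),
    argChange_zpow Real.two_pi_pos.le (by fun_prop) (fun t _ => sub_exp_mul_ne_zero hlead.ne t),
    argChange_sub_exp_eq_one hlead, levelWinding]
  split_ifs with h
  · rw [argChange_sub_exp_eq_one h]; norm_num
  · rw [argChange_sub_exp_eq_zero ((not_lt.1 h).lt_of_ne' hx)]; norm_num

section Family

variable {ι : Type*} {Γ : ι → Set ℂ} {m : ι → ℕ} {c : ι → ℝ → ℂ}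

theorem injective_lifts (hc : ∀ i, IsPeriodicLevelCurve u v (Γ i) (m i) (c i))
    (hdisj : Pairwise fun i j => Disjoint (Γ i) (Γ j)) {t : ℝ}
    (ht : ∀ z, u.eval z = Complex.exp (t * Complex.I) * v.eval z → (wronskian u v).eval z ≠ 0) :
    Function.Injective fun p : Σ i, Fin (m i) => c p.1 (t + (p.2 : ℕ) * (2 * Real.pi)) := by
  have hmem : ∀ i t, c i t ∈ Γ i := fun i t => (hc i).range_eq ▸ mem_range_self t
  rintro ⟨i, k⟩ ⟨j, l⟩ hkl
  change c i (t + (k : ℕ) * (2 * Real.pi)) = c j (t + (l : ℕ) * (2 * Real.pi)) at hkl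
  obtain rfl : i = j := hdisj.eq (not_disjoint_iff.2 ⟨_, hmem i _, hkl ▸ hmem j _⟩)
  have heval := (hc i).eval_eq (t + (k : ℕ) * (2 * Real.pi))
  rw [exp_add_natCast_mul] at heval
  obtain ⟨n, hn⟩ := (hc i).exists_int _ _ hkl (ht _ heval)
  have hdvd : ((k : ℕ) : ℤ) - (l : ℕ) = m i * n := by
    have : ((k : ℕ) : ℝ) - (l : ℕ) = m i * n :=
      mul_right_cancel₀ Real.two_pi_pos.ne' (by linear_combination hn)
    exact_mod_cast this
  have hzero : ((k : ℕ) : ℤ) - (l : ℕ) = 0 :=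
    Int.eq_zero_of_abs_lt_dvd ⟨n, hdvd⟩ (abs_lt.2 (by omega))
  obtain rfl : k = l := Fin.ext (by omega)
  rfl

theorem eval_levelPoly_eq_zero_iff_exists_lift (hcop : IsCoprime u v)
    (hinf : ∀ᶠ z in Bornology.cobounded ℂ, ‖u.eval z‖ < ‖v.eval z‖)
    (hc : ∀ i, IsPeriodicLevelCurve u v (Γ i) (m i) (c i)) (hcover : levelSet u v ⊆ ⋃ i, Γ i)
    (t : ℝ) (x : ℂ) :
    (levelPoly u v t).eval x = 0 ↔
      ∃ p : Σ i, Fin (m i), c p.1 (t + (p.2 : ℕ) * (2 * Real.pi)) = x := by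
  rw [eval_levelPoly_eq_zero_iff hinf]
  constructor
  · intro hx
    obtain ⟨i, hi⟩ := mem_iUnion.1 (hcover (mem_levelSet_of_eval_eq hx))
    obtain ⟨s, rfl⟩ := (hc i).range_eq ▸ hi
    obtain ⟨n, rfl⟩ := exists_int_of_exp_mul_I_eq (mul_right_cancel₀
      (eval_right_ne_zero hcop (mem_levelSet_of_eval_eq hx)) (((hc i).eval_eq s).symm.trans hx))
    obtain ⟨k, hk, l, hl⟩ := exists_natCast_eq_add_intCast_mul (hc i).pos n
    have hkR : (k : ℝ) = n + l * m i := by exact_mod_cast hl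
    refine ⟨⟨i, k, hk⟩, ?_⟩
    rw [← (hc i).periodic.int_mul l (t + n * (2 * Real.pi))]
    congr 1
    simp only
    rw [hkR]
    ring
  · rintro ⟨⟨i, k⟩, rfl⟩
    have heval := (hc i).eval_eq (t + (k : ℕ) * (2 * Real.pi))
    rwa [exp_add_natCast_mul] at heval

variable [Fintype ι]

theorem eval_levelPoly_eq_prod_lifts (hcop : IsCoprime u v)
    (hinf : ∀ᶠ z in Bornology.cobounded ℂ, ‖u.eval z‖ < ‖v.eval z‖)
    (hc : ∀ i, IsPeriodicLevelCurve u v (Γ i) (m i) (c i)) (hcover : levelSet u v ⊆ ⋃ i, Γ i)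
    (hdisj : Pairwise fun i j => Disjoint (Γ i) (Γ j)) (t : ℝ) (x : ℂ) :
    (levelPoly u v t).eval x =
      ∏ p : Σ i, Fin (m i), (x - c p.1 (t + (p.2 : ℕ) * (2 * Real.pi))) := by
  have hleft : Continuous fun t => (levelPoly u v t).eval x := by
    simp only [eval_levelPoly]
    exact Continuous.div (by fun_prop) (by fun_prop)
      (sub_exp_mul_ne_zero (norm_coeff_lt_of_eventually_norm_lt hinf).ne)
  have hright : Continuous fun t =>
      ∏ p : Σ i, Fin (m i), (x - c p.1 (t + (p.2 : ℕ) * (2 * Real.pi))) :=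
    continuous_finsetProd _ fun p _ =>
      continuous_const.sub ((hc p.1).continuous.comp (by fun_prop))
  refine congrFun (hleft.ext_on (dense_setOf_wronskian_ne_zero hcop hinf) hright
    fun s hs => ?_) t
  obtain ⟨z, hz⟩ := exists_isRootVector (ι := Fin v.natDegree) (monic_levelPoly hinf s)
    (by rw [natDegree_levelPoly hinf, Fintype.card_fin])
  have hzinj : Function.Injective z := fun i j hij => hz.eq_of_wronskian_ne_zero hinf hij
    (hs _ ((eval_levelPoly_eq_zero_iff hinf s _).1 (hz.eval_eq_zero_iff.2 ⟨i, rfl⟩)))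
  exact (hz.comp_of_injective hzinj (injective_lifts hc hdisj hs)
    (eval_levelPoly_eq_zero_iff_exists_lift hcop hinf hc hcover s)).eval_eq_prod x

theorem sum_argChange_sub_of_isPeriodicLevelCurve (hcop : IsCoprime u v)
    (hinf : ∀ᶠ z in Bornology.cobounded ℂ, ‖u.eval z‖ < ‖v.eval z‖)
    (hc : ∀ i, IsPeriodicLevelCurve u v (Γ i) (m i) (c i)) (hcover : levelSet u v ⊆ ⋃ i, Γ i)
    (hdisj : Pairwise fun i j => Disjoint (Γ i) (Γ j)) {x : ℂ} (hx : x ∉ levelSet u v) :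
    ∑ i, argChange (fun t => x - c i t) 0 (m i * (2 * Real.pi)) = levelWinding u v x := by
  have hcont : ∀ i, Continuous fun t => x - c i t := fun i =>
    continuous_const.sub (hc i).continuous
  have hne : ∀ i t, x - c i t ≠ 0 := fun i t h0 =>
    hx (sub_eq_zero.1 h0 ▸ mem_levelSet_of_eval_eq ((hc i).eval_eq t))
  calc ∑ i, argChange (fun t => x - c i t) 0 (m i * (2 * Real.pi))
      = ∑ i, ∑ k : Fin (m i),
          argChange (fun t => x - c i (t + (k : ℕ) * (2 * Real.pi))) 0 (2 * Real.pi) :=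
        Finset.sum_congr rfl fun i _ => by
          rw [← argChange_sum_range Real.two_pi_pos.le _ (hcont i).continuousOn
            fun t _ => hne i t, Finset.sum_range]
    _ = argChange (fun t => ∏ p : Σ i, Fin (m i),
          (x - c p.1 (t + (p.2 : ℕ) * (2 * Real.pi)))) 0 (2 * Real.pi) := by
        rw [argChange_prod Finset.univ Real.two_pi_pos.le
          (fun p _ => ((hcont p.1).comp (continuous_add_const _)).continuousOn)
          (fun p _ t _ => hne p.1 _), Fintype.sum_sigma]
    _ = levelWinding u v x := by
        rw [← argChange_levelPoly hinf hx]
        exact congrArg (argChange · 0 (2 * Real.pi)) (funext fun t =>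
          (eval_levelPoly_eq_prod_lifts hcop hinf hc hcover hdisj t x).symm)

end Family

theorem levelSet_subset_iUnion_levelComponents :
    levelSet u v ⊆ ⋃ Γ : levelComponents u v, Γ.1 := fun z hz =>
  mem_iUnion.2 ⟨⟨_, z, hz, rfl⟩, mem_connectedComponentIn hz⟩

theorem pairwise_disjoint_levelComponents :
    Pairwise fun Γ Γ' : levelComponents u v => Disjoint Γ.1 Γ'.1 := by
  rintro ⟨_, y, hy, rfl⟩ ⟨_, z, hz, rfl⟩ hne
  contrapose! hne
  obtain ⟨x, hxy, hxz⟩ := not_disjoint_iff.1 hne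
  exact Subtype.ext ((connectedComponentIn_eq hxy).trans (connectedComponentIn_eq hxz).symm)

theorem sum_argChange_sub_of_isLevelCurve (hcop : IsCoprime u v)
    (hinf : ∀ᶠ z in Bornology.cobounded ℂ, ‖u.eval z‖ < ‖v.eval z‖)
    [Fintype (levelComponents u v)] {γ : levelComponents u v → Curve}
    (hγ : ∀ Γ, IsLevelCurve u v Γ.1 (γ Γ)) {x : ℂ} (hx : x ∉ levelSet u v) :
    ∑ Γ, argChange (fun t => (γ Γ).toFun t - x) (γ Γ).a (γ Γ).b = levelWinding u v x := by
  choose m c hc hb heq using fun Γ => (hγ Γ).exists_isPeriodicLevelCurve hcop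
  rw [← sum_argChange_sub_of_isPeriodicLevelCurve hcop hinf hc
    levelSet_subset_iUnion_levelComponents pairwise_disjoint_levelComponents hx]
  refine Finset.sum_congr rfl fun Γ _ => ?_
  have hcont : Continuous fun t => x - c Γ t := continuous_const.sub (hc Γ).continuous
  have hne : ∀ t, x - c Γ t ≠ 0 := fun t h0 =>
    hx (sub_eq_zero.1 h0 ▸ mem_levelSet_of_eval_eq ((hc Γ).eval_eq t))
  calc argChange (fun t => (γ Γ).toFun t - x) (γ Γ).a (γ Γ).b
      = argChange (fun t => -(x - c Γ t)) (γ Γ).a (γ Γ).b :=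
        argChange_congr fun t ht => by simp only [heq Γ ht, neg_sub]
    _ = argChange (fun t => x - c Γ t) (γ Γ).a (γ Γ).b :=
        argChange_neg (γ Γ).a_lt_b.le hcont.continuousOn fun t _ => hne t
    _ = argChange (fun t => x - c Γ t) 0 (m Γ * (2 * Real.pi)) := by
        rw [hb, argChange_periodic_eq hcont hne (by positivity)
          (fun t => by rw [(hc Γ).periodic t]) (γ Γ).a 0, zero_add]

end TotalWinding

section HarmonicIndex

open Asymptotics

theorem hasLocalIndex_of_norm_sub_lt {F : ℂ → ℂ} {a w : ℂ} {n : ℤ}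
    (hF : ∀ᶠ z in 𝓝[≠] a, ContinuousAt F z)
    (hw : ∀ᶠ z in 𝓝[≠] a, ‖F z - w * (z - a) ^ n‖ < ‖w * (z - a) ^ n‖) :
    HasLocalIndex F a n := by
  have hquot : HasLocalIndex (fun z => F z / (z - a) ^ n) a 0 := by
    refine hasLocalIndex_zero_of_norm_sub_lt (w := w) ?_ ?_
    · filter_upwards [hF, self_mem_nhdsWithin] with z hz hza
      have h0 : z - a ≠ 0 := sub_ne_zero.2 hza
      exact hz.div ((continuousAt_id.sub continuousAt_const).zpow₀ n (Or.inl h0))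
        (zpow_ne_zero n h0)
    · filter_upwards [hw, self_mem_nhdsWithin] with z hz hza
      have h0 : (z - a) ^ n ≠ 0 := zpow_ne_zero n (sub_ne_zero.2 hza)
      rwa [div_sub' h0, norm_div, div_lt_iff₀ (norm_pos_iff.2 h0), ← norm_mul, mul_comm _ w]
  rw [← zero_add n]
  refine (hquot.mul (hasLocalIndex_sub_zpow a n)).congr ?_
  filter_upwards [self_mem_nhdsWithin] with z hza
  rw [div_mul_cancel₀ _ (zpow_ne_zero n (sub_ne_zero.2 hza))]

theorem exp_intCast_mul_two_log_norm (n : ℤ) {w : ℂ} (hw : w ≠ 0) :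
    Complex.exp (n * (2 * Real.log ‖w‖)) = w ^ n * starRingEnd ℂ w ^ n := by
  have hexp : Complex.exp (2 * Real.log ‖w‖) = ‖w‖ ^ 2 := by
    rw [two_mul, Complex.exp_add, ← Complex.ofReal_exp, Real.exp_log (norm_pos_iff.2 hw), sq]
  rw [Complex.exp_int_mul, hexp, ← mul_zpow, Complex.mul_conj']

theorem HasLocalIndex.conj {F : ℂ → ℂ} {a : ℂ} {n : ℤ} (h : HasLocalIndex F a n) :
    HasLocalIndex (fun z => starRingEnd ℂ (F z)) a (-n) := by
  obtain ⟨L, hL, hF⟩ := h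
  refine ⟨fun z => starRingEnd ℂ (L z) + n * (2 * Real.log ‖z - a‖), ?_, ?_⟩
  · filter_upwards [hL, self_mem_nhdsWithin] with z hz hza
    have hlog : ContinuousAt (fun z => Real.log ‖z - a‖) z :=
      (continuousAt_id.sub continuousAt_const).norm.log (norm_ne_zero_iff.2 (sub_ne_zero.2 hza))
    exact (Complex.continuous_conj.continuousAt.comp hz).add
      (continuousAt_const.mul (continuousAt_const.mul
        (Complex.continuous_ofReal.continuousAt.comp hlog)))
  · filter_upwards [hF, self_mem_nhdsWithin] with z hz hza
    have h0 : z - a ≠ 0 := sub_ne_zero.2 hza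
    rw [hz, Complex.exp_add, exp_intCast_mul_two_log_norm n h0, map_mul, map_zpow₀,
      ← Complex.exp_conj, zpow_neg]
    have := zpow_ne_zero n h0
    field_simp

section LeadingTerm

variable {F : ℂ → ℂ} {a α β : ℂ} {n : ℤ}

theorem hasLocalIndex_of_isLittleO_of_norm_lt (hF : ∀ᶠ z in 𝓝[≠] a, ContinuousAt F z)
    (hlead : (fun z => F z - (α * (z - a) ^ n + starRingEnd ℂ (β * (z - a) ^ n)))
      =o[𝓝[≠] a] fun z => (z - a) ^ n) (hβ : ‖β‖ < ‖α‖) : HasLocalIndex F a n := by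
  refine hasLocalIndex_of_norm_sub_lt (w := α) hF ?_
  filter_upwards [hlead.def (half_pos (sub_pos.2 hβ)), self_mem_nhdsWithin] with z hz hza
  have hpos : 0 < ‖(z - a) ^ n‖ := norm_pos_iff.2 (zpow_ne_zero n (sub_ne_zero.2 hza))
  calc ‖F z - α * (z - a) ^ n‖
      = ‖F z - (α * (z - a) ^ n + starRingEnd ℂ (β * (z - a) ^ n)) +
          starRingEnd ℂ (β * (z - a) ^ n)‖ := by ring_nf
    _ ≤ (‖α‖ - ‖β‖) / 2 * ‖(z - a) ^ n‖ + ‖β‖ * ‖(z - a) ^ n‖ := by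
        refine (norm_add_le _ _).trans (add_le_add hz ?_)
        rw [Complex.norm_conj, norm_mul]
    _ < ‖α * (z - a) ^ n‖ := by
        rw [norm_mul]
        nlinarith

theorem hasLocalIndex_of_isLittleO (hF : ∀ᶠ z in 𝓝[≠] a, ContinuousAt F z)
    (hlead : (fun z => F z - (α * (z - a) ^ n + starRingEnd ℂ (β * (z - a) ^ n)))
      =o[𝓝[≠] a] fun z => (z - a) ^ n) (hαβ : ‖α‖ ≠ ‖β‖) :
    HasLocalIndex F a (if ‖β‖ < ‖α‖ then n else -n) := by
  split_ifs with h
  · exact hasLocalIndex_of_isLittleO_of_norm_lt hF hlead h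
  · have hconj : HasLocalIndex (fun z => starRingEnd ℂ (F z)) a n := by
      refine hasLocalIndex_of_isLittleO_of_norm_lt (α := β) (β := α)
        (hF.mono fun z hz => Complex.continuous_conj.continuousAt.comp hz) ?_
        ((not_lt.1 h).lt_of_ne hαβ)
      refine hlead.norm_left.congr_left (fun z => ?_) |>.of_norm_left
      rw [← Complex.norm_conj]
      simp only [map_sub, map_add, Complex.conj_conj, add_comm]
    simpa only [Complex.conj_conj] using hconj.conj

end LeadingTerm

theorem fderiv_apply_eq (f : ℂ → ℂ) (z h : ℂ) :
    fderiv ℝ f z h = dz f z * h + dzbar f z * starRingEnd ℂ h := by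
  have hlin : fderiv ℝ f z h = h.re * fderiv ℝ f z 1 + h.im * fderiv ℝ f z Complex.I := by
    have hh : h = h.re • (1 : ℂ) + h.im • Complex.I := by simp
    conv_lhs => rw [hh]
    rw [map_add, map_smul, map_smul, Complex.real_smul, Complex.real_smul]
  rw [hlin, dz, dzbar, Complex.re_eq_add_conj, Complex.im_eq_sub_conj]
  field_simp
  linear_combination (h - starRingEnd ℂ h) * fderiv ℝ f z Complex.I * Complex.I_sq

theorem jacobian_pos_iff {f : ℂ → ℂ} {z : ℂ} : 0 < jacobian f z ↔ ‖dzbar f z‖ < ‖dz f z‖ := by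
  rw [jacobian, sub_pos, pow_lt_pow_iff_left₀ (norm_nonneg _) (norm_nonneg _) two_ne_zero]

theorem jacobian_neg_iff {f : ℂ → ℂ} {z : ℂ} : jacobian f z < 0 ↔ ‖dz f z‖ < ‖dzbar f z‖ := by
  rw [jacobian, sub_neg, pow_lt_pow_iff_left₀ (norm_nonneg _) (norm_nonneg _) two_ne_zero]

theorem jacobian_eq_zero_iff {f : ℂ → ℂ} {z : ℂ} :
    jacobian f z = 0 ↔ ‖dz f z‖ = ‖dzbar f z‖ := by
  rw [jacobian, sub_eq_zero, pow_left_inj₀ (norm_nonneg _) (norm_nonneg _) two_ne_zero]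

theorem hasLocalIndex_of_jacobian_ne_zero {f : ℂ → ℂ} {a η : ℂ}
    (hc : ∀ᶠ z in 𝓝 a, ContinuousAt f z) (hd : DifferentiableAt ℝ f a) (ha : f a = η)
    (hJ : jacobian f a ≠ 0) :
    HasLocalIndex (fun z => f z - η) a (if 0 < jacobian f a then 1 else -1) := by
  have hlead : (fun z => f z - η - (dz f a * (z - a) ^ (1 : ℤ) +
      starRingEnd ℂ (starRingEnd ℂ (dzbar f a) * (z - a) ^ (1 : ℤ))))
      =o[𝓝[≠] a] fun z => (z - a) ^ (1 : ℤ) := by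
    refine (hd.hasFDerivAt.isLittleO.mono nhdsWithin_le_nhds).congr (fun z => ?_) fun z => ?_
    · simp only [fderiv_apply_eq, ha, zpow_one, map_mul, Complex.conj_conj]
    · rw [zpow_one]
  have hcont : ∀ᶠ z in 𝓝[≠] a, ContinuousAt (fun z => f z - η) z :=
    (hc.filter_mono nhdsWithin_le_nhds).mono fun z hz => hz.sub continuousAt_const
  simpa only [jacobian_pos_iff, Complex.norm_conj] using hasLocalIndex_of_isLittleO hcont hlead
    (by rwa [Complex.norm_conj, Ne, ← jacobian_eq_zero_iff])

theorem isLittleO_log_norm_sub_zpow (p : ℂ) {n : ℕ} (hn : 1 ≤ n) :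
    (fun z => (Real.log ‖z - p‖ : ℂ)) =o[𝓝[≠] p] fun z => (z - p) ^ (-n : ℤ) := by
  have hpow : (fun x : ℝ => Real.log x) =o[𝓝[>] 0] fun x => x ^ (-n : ℝ) :=
    isLittleO_log_rpow_nhdsGT_zero (neg_lt_zero.2 (Nat.cast_pos.2 hn))
  rw [← isLittleO_norm_right, isLittleO_iff]
  refine fun ε hε => ((hpow.comp_tendsto (tendsto_norm_sub_self_nhdsNE p)).def hε).mono
    fun z hz => ?_
  simpa [Real.rpow_neg, Real.rpow_natCast] using hz

theorem isLittleO_const_log_norm_sub (η p : ℂ) :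
    (fun _ => η) =o[𝓝[≠] p] fun z => (Real.log ‖z - p‖ : ℂ) :=
  isLittleO_const_left.2 <| Or.inr <| by
    simpa only [Function.comp_def, Complex.norm_real, Real.norm_eq_abs] using
      tendsto_abs_atBot_atTop.comp
        (Real.tendsto_log_nhdsGT_zero.comp (tendsto_norm_sub_self_nhdsNE p))

theorem isLittleO_sub_mul_of_continuousAt {A : ℂ → ℂ} {p : ℂ} (hA : ContinuousAt A p)
    (g : ℂ → ℂ) : (fun z => (A z - A p) * g z) =o[𝓝[≠] p] g := by
  have hsub : (fun z => A z - A p) =o[𝓝[≠] p] fun _ => (1 : ℂ) :=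
    (isLittleO_one_iff ℂ).2 ((tendsto_sub_nhds_zero_iff.2 hA).mono_left nhdsWithin_le_nhds)
  simpa only [one_mul] using hsub.mul_isBigO (isBigO_refl g _)

theorem hasLocalIndex_of_pole {f A B : ℂ → ℂ} {p c : ℂ} {n : ℕ} (hn : 1 ≤ n)
    (hA : ContinuousAt A p) (hB : ContinuousAt B p) (hAB : ‖A p‖ ≠ ‖B p‖)
    (hc : ∀ᶠ z in 𝓝[≠] p, ContinuousAt f z)
    (hf : ∀ᶠ z in 𝓝[≠] p, f z = A z / (z - p) ^ n + starRingEnd ℂ (B z / (z - p) ^ n)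
      + c * (Real.log ‖z - p‖ : ℂ)) (η : ℂ) :
    HasLocalIndex (fun z => f z - η) p (if ‖B p‖ < ‖A p‖ then -n else n) := by
  have hlog := isLittleO_log_norm_sub_zpow p hn
  have hconj : (fun z => starRingEnd ℂ ((B z - B p) * (z - p) ^ (-n : ℤ)))
      =o[𝓝[≠] p] fun z => (z - p) ^ (-n : ℤ) :=
    IsLittleO.of_norm_left <| by
      simpa only [Complex.norm_conj] using (isLittleO_sub_mul_of_continuousAt hB _).norm_left
  have hlead : (fun z => f z - η - (A p * (z - p) ^ (-n : ℤ) +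
      starRingEnd ℂ (B p * (z - p) ^ (-n : ℤ)))) =o[𝓝[≠] p] fun z => (z - p) ^ (-n : ℤ) := by
    refine ((((isLittleO_sub_mul_of_continuousAt hA _).add hconj).add
      (hlog.const_mul_left c)).sub ((isLittleO_const_log_norm_sub η p).trans hlog)).congr' ?_
      EventuallyEq.rfl
    filter_upwards [hf] with z hz
    rw [hz]
    simp only [zpow_neg, zpow_natCast, map_mul, map_sub, div_eq_mul_inv]
    ring
  have hindex := hasLocalIndex_of_isLittleO (F := fun z => f z - η)
    (hc.mono fun z hz => hz.sub continuousAt_const) hlead hAB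
  rwa [neg_neg] at hindex

end HarmonicIndex

section Wirtinger

theorem dz_conj (f : ℂ → ℂ) (z : ℂ) :
    dz (fun w => starRingEnd ℂ (f w)) z = starRingEnd ℂ (dzbar f z) := by
  have hfderiv : fderiv ℝ (fun w => starRingEnd ℂ (f w)) z =
      (Complex.conjCLE : ℂ →L[ℝ] ℂ).comp (fderiv ℝ f z) := Complex.conjCLE.comp_fderiv
  simp only [dz, dzbar, hfderiv, ContinuousLinearMap.comp_apply, ContinuousLinearEquiv.coe_coe,
    Complex.conjCLE_apply, map_div₀, map_add, map_mul, Complex.conj_I, Complex.conj_ofNat]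
  ring

theorem analyticAt_dz {f : ℂ → ℂ} {z : ℂ} (hf : InnerProductSpace.HarmonicAt f z) :
    AnalyticAt ℂ (dz f) z := by
  have hre := HarmonicAt.analyticAt_complex_partial (hf.comp_CLM Complex.reCLM)
  have him := HarmonicAt.analyticAt_complex_partial (hf.comp_CLM Complex.imCLM)
  have hsum : AnalyticAt ℂ (fun w => (_ + Complex.I * _) / 2) z :=
    (hre.add ((analyticAt_const (v := Complex.I)).mul him)).div_const
  refine hsum.congr ?_
  filter_upwards [hf.1.eventually (by simp)] with w hw
  have hd := (hw.differentiableAt (by norm_num)).hasFDerivAt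
  have hfderiv : ∀ h, fderiv ℝ f w h = (fderiv ℝ (Complex.reCLM ∘ f) w h : ℂ) +
      Complex.I * (fderiv ℝ (Complex.imCLM ∘ f) w h : ℂ) := fun h => by
    rw [(Complex.reCLM.hasFDerivAt.comp w hd).fderiv, (Complex.imCLM.hasFDerivAt.comp w hd).fderiv]
    simp only [ContinuousLinearMap.comp_apply, Complex.reCLM_apply, Complex.imCLM_apply]
    rw [mul_comm, Complex.re_add_im]
  simp only [dz, hfderiv]
  ring

theorem analyticAt_conj_dzbar {f : ℂ → ℂ} {z : ℂ} (hf : InnerProductSpace.HarmonicAt f z) :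
    AnalyticAt ℂ (fun w => starRingEnd ℂ (dzbar f w)) z := by
  simp only [← dz_conj]
  exact analyticAt_dz (hf.comp_CLM (Complex.conjCLE : ℂ →L[ℝ] ℂ))

theorem dz_eq_of_eventuallyEq {f H G : ℂ → ℂ} {z H' G' : ℂ} (hH : HasDerivAt H H' z)
    (hG : HasDerivAt G G' z) (hf : f =ᶠ[𝓝 z] fun w => H w + starRingEnd ℂ (G w)) :
    dz f z = H' := by
  have hderiv : HasFDerivAt (fun w => H w + starRingEnd ℂ (G w))
      (H' • (1 : ℂ →L[ℝ] ℂ) + (Complex.conjCLE : ℂ →L[ℝ] ℂ).comp (G' • (1 : ℂ →L[ℝ] ℂ))) z :=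
    hH.complexToReal_fderiv.add
      ((Complex.conjCLE : ℂ →L[ℝ] ℂ).hasFDerivAt.comp z hG.complexToReal_fderiv)
  rw [dz, hf.fderiv_eq, hderiv.fderiv]
  simp only [add_apply, smul_apply,
    ContinuousLinearMap.comp_apply, one_apply_eq_self, ContinuousLinearEquiv.coe_coe,
    Complex.conjCLE_apply, smul_eq_mul, map_mul, mul_one, Complex.conj_I]
  linear_combination (-(H' - starRingEnd ℂ G') / 2) * Complex.I_sq

theorem exists_hasDerivAt_log_norm_sub_eq {p z : ℂ} (hz : z ≠ p) :
    ∃ l : ℂ → ℂ, HasDerivAt l (z - p)⁻¹ z ∧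
      ∀ᶠ w in 𝓝 z, (Real.log ‖w - p‖ : ℂ) = (l w + starRingEnd ℂ (l w)) / 2 := by
  have h0 : z - p ≠ 0 := sub_ne_zero.2 hz
  refine ⟨fun w => Complex.log ((w - p) / (z - p)) + Real.log ‖z - p‖, ?_, ?_⟩
  · have hquot : HasDerivAt (fun w => (w - p) / (z - p)) (z - p)⁻¹ z := by
      simpa only [one_div] using ((hasDerivAt_id' z).sub_const p).div_const (z - p)
    simpa only [div_self h0, div_one] using
      (hquot.clog (by simp only [div_self h0, Complex.one_mem_slitPlane])).add_const _
  · filter_upwards [isOpen_ne.mem_nhds hz] with w hw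
    rw [Complex.add_conj, Complex.add_re, Complex.log_re, Complex.ofReal_re, norm_div,
      Real.log_div (norm_ne_zero_iff.2 (sub_ne_zero.2 hw)) (norm_ne_zero_iff.2 h0)]
    push_cast
    ring

/-- The numerator, over the denominator `(z - p) ^ (n + 1)`, of the derivative of
`A z / (z - p) ^ n + (c / 2) * log (z - p)`. -/
noncomputable def poleNumerator (A : ℂ → ℂ) (p : ℂ) (n : ℕ) (c z : ℂ) : ℂ :=
  (z - p) * deriv A z - n * A z + c / 2 * (z - p) ^ n

theorem analyticAt_poleNumerator {A : ℂ → ℂ} {p : ℂ} (hA : AnalyticAt ℂ A p) (n : ℕ) (c : ℂ) :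
    AnalyticAt ℂ (poleNumerator A p n c) p := by
  have hsub : AnalyticAt ℂ (fun z : ℂ => z - p) p := analyticAt_id.sub analyticAt_const
  exact ((hsub.mul hA.deriv).sub (analyticAt_const.mul hA)).add
    (analyticAt_const.mul (hsub.pow n))

theorem poleNumerator_self (A : ℂ → ℂ) (p : ℂ) {n : ℕ} (hn : n ≠ 0) (c : ℂ) :
    poleNumerator A p n c p = -n * A p := by
  simp [poleNumerator, hn]

theorem hasDerivAt_div_pow_add_mul_log {A l : ℂ → ℂ} {p z : ℂ} (hA : DifferentiableAt ℂ A z)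
    (hl : HasDerivAt l (z - p)⁻¹ z) (hz : z ≠ p) (n : ℕ) (c : ℂ) :
    HasDerivAt (fun w => A w / (w - p) ^ n + c / 2 * l w)
      (poleNumerator A p n c z / (z - p) ^ (n + 1)) z := by
  have h0 : z - p ≠ 0 := sub_ne_zero.2 hz
  refine ((hA.hasDerivAt.div (((hasDerivAt_id' z).sub_const p).fun_pow n) (pow_ne_zero n h0)).add
    (hl.const_mul (c / 2))).congr_deriv ?_
  rw [poleNumerator]
  rcases n with _ | m
  · field_simp
    ring
  · simp only [Nat.add_sub_cancel]
    field_simp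
    ring

theorem eventually_dz_eq_of_pole {f A B : ℂ → ℂ} {p c : ℂ} {n : ℕ} (hA : AnalyticAt ℂ A p)
    (hB : AnalyticAt ℂ B p)
    (hf : ∀ᶠ z in 𝓝[≠] p, f z = A z / (z - p) ^ n + starRingEnd ℂ (B z / (z - p) ^ n)
      + c * (Real.log ‖z - p‖ : ℂ)) :
    ∀ᶠ z in 𝓝[≠] p, dz f z = poleNumerator A p n c z / (z - p) ^ (n + 1) := by
  filter_upwards [eventually_eventually_nhdsWithin.2 hf, self_mem_nhdsWithin,
    hA.eventually_analyticAt.filter_mono nhdsWithin_le_nhds,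
    hB.eventually_analyticAt.filter_mono nhdsWithin_le_nhds] with z hz hzp hAz hBz
  rw [isOpen_compl_singleton.nhdsWithin_eq hzp] at hz
  obtain ⟨l, hl, hlog⟩ := exists_hasDerivAt_log_norm_sub_eq hzp
  refine dz_eq_of_eventuallyEq (hasDerivAt_div_pow_add_mul_log hAz.differentiableAt hl hzp n c)
    (hasDerivAt_div_pow_add_mul_log hBz.differentiableAt hl hzp n (starRingEnd ℂ c)) ?_
  filter_upwards [hz, hlog] with w hw hlw
  rw [hw, hlw]
  simp only [map_add, map_mul, map_div₀, Complex.conj_conj, Complex.conj_ofNat]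
  ring

theorem eventually_conj_dzbar_eq_of_pole {f A B : ℂ → ℂ} {p c : ℂ} {n : ℕ}
    (hA : AnalyticAt ℂ A p) (hB : AnalyticAt ℂ B p)
    (hf : ∀ᶠ z in 𝓝[≠] p, f z = A z / (z - p) ^ n + starRingEnd ℂ (B z / (z - p) ^ n)
      + c * (Real.log ‖z - p‖ : ℂ)) :
    ∀ᶠ z in 𝓝[≠] p, starRingEnd ℂ (dzbar f z) =
      poleNumerator B p n (starRingEnd ℂ c) z / (z - p) ^ (n + 1) := by
  simp only [← dz_conj]
  refine eventually_dz_eq_of_pole hB hA (hf.mono fun z hz => ?_)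
  rw [hz]
  simp only [map_add, map_mul, Complex.conj_conj, Complex.conj_ofReal]
  ring

end Wirtinger

theorem finite_of_eventually_notMem {X : Type*} [PseudoMetricSpace X] [ProperSpace X] {S : Set X}
    (hb : ∀ᶠ z in Bornology.cobounded X, z ∉ S) (h : ∀ z, ∀ᶠ w in 𝓝[≠] z, w ∉ S) :
    S.Finite := by
  by_contra hinf
  have hS : Bornology.IsBounded S := Bornology.isBounded_def.2 hb
  obtain ⟨x, -, hx⟩ := Set.Infinite.exists_accPt_of_subset_isCompact hinf
    hS.isCompact_closure subset_closure
  exact accPt_iff_frequently_nhdsNE.1 hx (h x)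

section Rational

open Polynomial Asymptotics

theorem isBounded_range_of_isBigO_one {ψ : ℂ → ℂ} (hψ : Continuous ψ)
    (h : ψ =O[Bornology.cobounded ℂ] fun _ => (1 : ℂ)) : Bornology.IsBounded (range ψ) := by
  obtain ⟨C, hC⟩ := h.bound
  obtain ⟨R, -, hR⟩ := (Metric.hasBasis_cobounded_compl_closedBall 0).eventually_iff.1 hC
  refine (((isCompact_closedBall 0 R).image hψ).isBounded.union
    (Metric.isBounded_closedBall (x := 0) (r := C))).subset ?_
  rintro _ ⟨z, rfl⟩
  by_cases hz : z ∈ Metric.closedBall 0 R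
  · exact Or.inl (mem_image_of_mem ψ hz)
  · exact Or.inr (by simpa using hR hz)

theorem isBigO_dslope_zero {ψ : ℂ → ℂ} {N : ℕ}
    (h : ψ =O[Bornology.cobounded ℂ] (· ^ (N + 1))) :
    dslope ψ 0 =O[Bornology.cobounded ℂ] (· ^ N) := by
  have hne : ∀ᶠ z : ℂ in Bornology.cobounded ℂ, z ≠ 0 :=
    Bornology.eventually_ne_cobounded 0
  have hconst : (fun _ => ψ 0) =O[Bornology.cobounded ℂ] fun z : ℂ => z ^ (N + 1) := by
    have hX := isBigO_cobounded_of_degree_le (P := C (ψ 0)) (Q := X ^ (N + 1))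
      (degree_C_le.trans (zero_le_degree_iff.2 (pow_ne_zero _ X_ne_zero)))
    simpa only [eval_C, eval_pow, eval_X] using hX
  refine ((isBigO_refl (fun z : ℂ => z⁻¹) _).mul (h.sub hconst)).congr' ?_ ?_
  · filter_upwards [hne] with z hz
    rw [dslope_of_ne _ hz, slope_def_field, sub_zero, inv_mul_eq_div]
  · filter_upwards [hne] with z hz
    rw [pow_succ', inv_mul_cancel_left₀ hz]

theorem exists_polynomial_of_isBigO_pow {ψ : ℂ → ℂ} (hψ : Differentiable ℂ ψ) {N : ℕ}
    (h : ψ =O[Bornology.cobounded ℂ] (· ^ N)) : ∃ q : ℂ[X], ∀ z, ψ z = q.eval z := by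
  induction N generalizing ψ with
  | zero =>
    obtain ⟨c, hc⟩ := hψ.exists_const_forall_eq_of_bounded
      (isBounded_range_of_isBigO_one hψ.continuous (by simpa only [pow_zero] using h))
    exact ⟨C c, fun z => by rw [hc, eval_C]⟩
  | succ N ih =>
    have hd : Differentiable ℂ (dslope ψ 0) := by
      rw [← differentiableOn_univ, Complex.differentiableOn_dslope univ_mem]
      exact hψ.differentiableOn
    obtain ⟨q, hq⟩ := ih hd (isBigO_dslope_zero h)
    refine ⟨C (ψ 0) + X * q, fun z => ?_⟩
    rw [eval_add, eval_C, eval_mul, eval_X, ← hq]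
    linear_combination -sub_smul_dslope ψ 0 z

theorem exists_polynomial_differentiable_mul {φ : ℂ → ℂ} (hφ : ∀ z, MeromorphicAt φ z)
    (hinf : ∀ᶠ z in Bornology.cobounded ℂ, AnalyticAt ℂ φ z) :
    ∃ v : ℂ[X], v ≠ 0 ∧ Differentiable ℂ fun z => φ z * v.eval z := by
  classical
  have hfin : {z | ¬AnalyticAt ℂ φ z}.Finite := finite_of_eventually_notMem
    (hinf.mono fun z hz h => h hz) fun z => (hφ z).eventually_analyticAt.mono fun w hw h => h hw
  choose n hn using hφ
  refine ⟨∏ a ∈ hfin.toFinset, (X - C a) ^ n a,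
    Finset.prod_ne_zero_iff.2 fun a _ => pow_ne_zero _ (X_sub_C_ne_zero a), fun z => ?_⟩
  by_cases hz : AnalyticAt ℂ φ z
  · exact hz.differentiableAt.mul (Polynomial.differentiable _ z)
  · have hmem : z ∈ hfin.toFinset := hfin.mem_toFinset.2 hz
    have herase := Polynomial.differentiable (∏ a ∈ hfin.toFinset.erase z, (X - C a) ^ n a) z
    refine ((hn z).differentiableAt.mul herase).congr_of_eventuallyEq
      (Eventually.of_forall fun w => ?_)
    simp only [← Finset.mul_prod_erase _ _ hmem, eval_mul, eval_pow, eval_sub, eval_X, eval_C,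
      Pi.mul_apply, smul_eq_mul]
    ring

theorem eventually_cofinite_eval_ne_zero {R : Type*} [CommRing R] [IsDomain R] {p : R[X]}
    (hp : p ≠ 0) : ∀ᶠ x in cofinite, p.eval x ≠ 0 :=
  (finite_setOfPred_isRoot hp).eventually_cofinite_notMem

theorem exists_isCoprime_eval_div_eq {K : Type*} [Field K] (u : K[X]) {v : K[X]} (hv : v ≠ 0) :
    ∃ u' v' : K[X], IsCoprime u' v' ∧ v' ≠ 0 ∧
      ∀ᶠ x in cofinite, u.eval x / v.eval x = u'.eval x / v'.eval x := by
  classical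
  have hg : gcd u v ≠ 0 := gcd_ne_zero_of_right hv
  have hu_mul : gcd u v * (u / gcd u v) = u := EuclideanDomain.mul_div_cancel' hg (gcd_dvd_left u v)
  have hv_mul : gcd u v * (v / gcd u v) = v :=
    EuclideanDomain.mul_div_cancel' hg (gcd_dvd_right u v)
  refine ⟨u / gcd u v, v / gcd u v, isCoprime_div_gcd_div_gcd hv,
    fun h0 => hv (by rw [← hv_mul, h0, mul_zero]), ?_⟩
  filter_upwards [eventually_cofinite_eval_ne_zero hg] with x hx
  rw [← mul_div_mul_left ((u / gcd u v).eval x) _ hx, ← eval_mul, ← eval_mul, hu_mul, hv_mul]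

theorem exists_eval_div_eq_of_meromorphicAt {φ : ℂ → ℂ} (hφ : ∀ z, MeromorphicAt φ z)
    (hinf : ∀ᶠ z in Bornology.cobounded ℂ, AnalyticAt ℂ φ z)
    (hbdd : φ =O[Bornology.cobounded ℂ] fun _ => (1 : ℂ)) :
    ∃ u v : ℂ[X], IsCoprime u v ∧ v ≠ 0 ∧ ∀ᶠ z in cofinite, φ z = u.eval z / v.eval z := by
  obtain ⟨v, hv, hd⟩ := exists_polynomial_differentiable_mul hφ hinf
  have hgrowth : (fun z => φ z * v.eval z) =O[Bornology.cobounded ℂ] (· ^ v.natDegree) := by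
    have hX := isBigO_cobounded_of_degree_le (P := v) (Q := X ^ v.natDegree)
      (by rw [degree_X_pow]; exact degree_le_natDegree)
    simpa only [one_mul, eval_pow, eval_X] using hbdd.mul hX
  obtain ⟨u, hu⟩ := exists_polynomial_of_isBigO_pow hd hgrowth
  obtain ⟨u', v', hcop, hv', huv⟩ := exists_isCoprime_eval_div_eq u hv
  refine ⟨u', v', hcop, hv', ?_⟩
  filter_upwards [huv, eventually_cofinite_eval_ne_zero hv] with z hz hvz
  rw [← hz, ← hu, mul_div_cancel_right₀ _ hvz]

theorem norm_eval_lt_of_mul_eq {u v : ℂ[X]} (hcop : IsCoprime u v) {x h g : ℂ}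
    (heq : u.eval x * h = v.eval x * g) (hlt : ‖g‖ < ‖h‖) : ‖u.eval x‖ < ‖v.eval x‖ := by
  have hh : 0 < ‖h‖ := (norm_nonneg g).trans_lt hlt
  have hnorm : ‖u.eval x‖ * ‖h‖ = ‖v.eval x‖ * ‖g‖ := by rw [← norm_mul, heq, norm_mul]
  have hv : v.eval x ≠ 0 := fun hv =>
    (aeval_ne_zero_of_isCoprime hcop x).elim
      (· ((mul_eq_zero.1 (heq.trans (by rw [hv, zero_mul]))).resolve_right (norm_pos_iff.1 hh)))
      (· hv)
  exact lt_of_mul_lt_mul_right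
    (hnorm.trans_lt (mul_lt_mul_of_pos_left hlt (norm_pos_iff.2 hv))) hh.le

end Rational

section RationalDilatation

open Polynomial Asymptotics

theorem eventually_notMem_nhds {P : Finset ℂ} {z : ℂ} (hz : z ∉ P) : ∀ᶠ w in 𝓝 z, w ∉ P :=
  P.finite_toSet.isClosed.isOpen_compl.mem_nhds hz

theorem eventually_notMem_nhdsNE (P : Finset ℂ) (z : ℂ) : ∀ᶠ w in 𝓝[≠] z, w ∉ P :=
  P.finite_toSet.eventually_cofinite_notMem.filter_mono (nhdsNE_le_cofinite z)

namespace IsNondegenerate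

variable {f : ℂ → ℂ} {P : Finset ℂ} (hf : IsNondegenerate f P)
include hf

theorem harmonicAt {z : ℂ} (hz : z ∉ P) : InnerProductSpace.HarmonicAt f z :=
  hf.harmonic z hz

theorem continuousAt {z : ℂ} (hz : z ∉ P) : ContinuousAt f z :=
  (hf.harmonicAt hz).1.continuousAt

theorem meromorphicAt_dz (z : ℂ) : MeromorphicAt (dz f) z := by
  by_cases hz : z ∈ P
  · obtain ⟨n, A, B, c, -, hA, hB, -, hform⟩ := hf.pole_form z hz
    exact ((analyticAt_poleNumerator hA n c).meromorphicAt.div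
      (((MeromorphicAt.id z).sub (MeromorphicAt.const z z)).pow (n + 1))).congr
      ((eventually_dz_eq_of_pole hA hB hform).mono fun w hw => hw.symm)
  · exact (analyticAt_dz (hf.harmonicAt hz)).meromorphicAt

theorem meromorphicAt_conj_dzbar (z : ℂ) :
    MeromorphicAt (fun w => starRingEnd ℂ (dzbar f w)) z := by
  by_cases hz : z ∈ P
  · obtain ⟨n, A, B, c, -, hA, hB, -, hform⟩ := hf.pole_form z hz
    exact ((analyticAt_poleNumerator hB n _).meromorphicAt.div
      (((MeromorphicAt.id z).sub (MeromorphicAt.const z z)).pow (n + 1))).congr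
      ((eventually_conj_dzbar_eq_of_pole hA hB hform).mono fun w hw => hw.symm)
  · exact (analyticAt_conj_dzbar (hf.harmonicAt hz)).meromorphicAt

theorem eventually_cobounded_norm_dzbar_lt :
    ∀ᶠ z in Bornology.cobounded ℂ, z ∉ P ∧ ‖dzbar f z‖ < ‖dz f z‖ :=
  .and (Bornology.isBounded_def.1 P.finite_toSet.isBounded)
    (hf.sense_preserving_at_infty.mono fun _ => jacobian_pos_iff.1)

theorem eventually_nhdsNE_dz_ne_zero {z : ℂ} (hz : z ∉ P) : ∀ᶠ w in 𝓝[≠] z, dz f w ≠ 0 := by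
  have han : AnalyticOnNhd ℂ (dz f) (P : Set ℂ)ᶜ := fun w hw => analyticAt_dz (hf.harmonicAt hw)
  refine (han z hz).eventually_eq_zero_or_eventually_ne_zero.resolve_left fun h0 => ?_
  have hconn : IsPreconnected ((P : Set ℂ)ᶜ) :=
    (P.finite_toSet.countable.isPathConnected_compl_of_one_lt_rank
      (by rw [Complex.rank_real_complex]; norm_num)).isConnected.isPreconnected
  obtain ⟨w, hw, hlt⟩ := hf.eventually_cobounded_norm_dzbar_lt.exists
  have hw0 : dz f w = 0 := han.eqOn_zero_of_preconnected_of_eventuallyEq_zero hconn hz h0 hw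
  exact (norm_nonneg _).not_gt (by simpa only [hw0, norm_zero] using hlt)

theorem exists_dilatation_eq : ∃ u v : ℂ[X], IsCoprime u v ∧ v ≠ 0 ∧
    ∀ᶠ z in cofinite, starRingEnd ℂ (dzbar f z) / dz f z = u.eval z / v.eval z := by
  refine exists_eval_div_eq_of_meromorphicAt
    (fun z => (hf.meromorphicAt_conj_dzbar z).div (hf.meromorphicAt_dz z)) ?_ ?_
  · filter_upwards [hf.eventually_cobounded_norm_dzbar_lt] with z ⟨hz, hlt⟩
    exact (analyticAt_conj_dzbar (hf.harmonicAt hz)).div (analyticAt_dz (hf.harmonicAt hz))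
      (norm_pos_iff.1 ((norm_nonneg _).trans_lt hlt))
  · refine IsBigO.of_bound 1 ?_
    filter_upwards [hf.eventually_cobounded_norm_dzbar_lt] with z ⟨_, hlt⟩
    rw [norm_div, Complex.norm_conj, norm_one, mul_one]
    exact div_le_one_of_le₀ hlt.le (norm_nonneg _)

end IsNondegenerate

/-- `u / v`, in lowest terms, is the second complex dilatation of `f`. -/
structure IsRationalDilatation (f : ℂ → ℂ) (P : Finset ℂ) (u v : ℂ[X]) : Prop where
  isCoprime : IsCoprime u v
  norm_lt : ∀ᶠ z in Bornology.cobounded ℂ, ‖u.eval z‖ < ‖v.eval z‖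
  dilatation_eq : ∀ z ∉ P, dilatation f P z = u.eval z / v.eval z
  mul_dz : ∀ z ∉ P, u.eval z * dz f z = v.eval z * starRingEnd ℂ (dzbar f z)

theorem IsNondegenerate.exists_isRationalDilatation {f : ℂ → ℂ} {P : Finset ℂ}
    (hf : IsNondegenerate f P) : ∃ u v : ℂ[X], IsRationalDilatation f P u v := by
  obtain ⟨u, v, hcop, hv, huv⟩ := hf.exists_dilatation_eq
  have hmul : ∀ z ∉ P, u.eval z * dz f z = v.eval z * starRingEnd ℂ (dzbar f z) := by
    intro z hz
    have hleft : ContinuousAt (fun w => u.eval w * dz f w) z :=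
      u.continuousAt.mul (analyticAt_dz (hf.harmonicAt hz)).continuousAt
    have hright : ContinuousAt (fun w => v.eval w * starRingEnd ℂ (dzbar f w)) z :=
      v.continuousAt.mul (analyticAt_conj_dzbar (hf.harmonicAt hz)).continuousAt
    refine ((hleft.eventuallyEq_nhds_iff_eventuallyEq_nhdsNE hright).1 ?_).self_of_nhds
    filter_upwards [huv.filter_mono (nhdsNE_le_cofinite z), hf.eventually_nhdsNE_dz_ne_zero hz,
      (eventually_cofinite_eval_ne_zero hv).filter_mono (nhdsNE_le_cofinite z)] with w hw hdz hvw
    rw [div_eq_div_iff hdz hvw] at hw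
    rw [← hw, mul_comm]
  refine ⟨u, v, hcop, ?_, fun z hz => ?_, hmul⟩
  · filter_upwards [hf.eventually_cobounded_norm_dzbar_lt] with z ⟨hz, hlt⟩
    exact norm_eval_lt_of_mul_eq hcop (hmul z hz) (by rwa [Complex.norm_conj])
  · have hNF : MeromorphicNFAt (fun w => u.eval w / v.eval w) z :=
      MeromorphicNFOn.div (u.differentiable.analyticAt z)
        (v.differentiable.analyticAt z).meromorphicNFAt
        ((aeval_ne_zero_of_isCoprime hcop z).symm)
    have hmer : MeromorphicOn (fun w => starRingEnd ℂ (dzbar f w) / dz f w) (P : Set ℂ)ᶜ :=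
      fun w _ => (hf.meromorphicAt_conj_dzbar w).div (hf.meromorphicAt_dz w)
    rw [dilatation, toMeromorphicNFOn_eq_toMeromorphicNFAt hmer (by simpa using hz),
      (toMeromorphicNFAt_eventuallyEq_nhds_congr
        (huv.filter_mono (nhdsNE_le_cofinite z))).self_of_nhds,
      toMeromorphicNFAt_eq_self.2 hNF]

end RationalDilatation

section CriticalCurves

open Polynomial

variable {f : ℂ → ℂ} {P : Finset ℂ} {η : ℂ}

namespace IsNondegenerate

variable (hf : IsNondegenerate f P)
include hf

theorem hasLocalIndex_sub_of_mem_preimages {z : ℂ} (hz : z ∈ preimages f P η)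
    (hη : η ∉ f '' criticalSet f P) :
    HasLocalIndex (fun w => f w - η) z (if 0 < jacobian f z then 1 else -1) :=
  hasLocalIndex_of_jacobian_ne_zero
    ((eventually_notMem_nhds hz.1).mono fun w hw => hf.continuousAt hw)
    ((hf.harmonicAt hz.1).1.differentiableAt (by norm_num)) hz.2
    fun hJ => hη ⟨z, ⟨hz.1, hJ⟩, hz.2⟩

theorem finite_preimages (hη : η ∉ f '' criticalSet f P)
    (hinf : ∀ᶠ z in Bornology.cobounded ℂ, f z - η ≠ 0) : (preimages f P η).Finite := by
  refine finite_of_eventually_notMem (hinf.mono fun z hz h => hz (sub_eq_zero.2 h.2)) fun z => ?_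
  by_cases hz : z ∈ P
  · exact ((hf.pole z hz).eventually (Bornology.eventually_ne_cobounded η)).mono
      fun w hw h => hw h.2
  by_cases hzη : f z = η
  · exact (hf.hasLocalIndex_sub_of_mem_preimages ⟨hz, hzη⟩ hη).eventually_ne_zero.mono
      fun w hw h => hw (sub_eq_zero.2 h.2)
  · exact (((hf.continuousAt hz).eventually_ne hzη).filter_mono nhdsWithin_le_nhds).mono
      fun w hw h => hw h.2

end IsNondegenerate

namespace IsRationalDilatation

variable {u v : ℂ[X]} (h : IsRationalDilatation f P u v)
include h

theorem norm_eval_lt_of_jacobian_pos {z : ℂ} (hz : z ∉ P) (hJ : 0 < jacobian f z) :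
    ‖u.eval z‖ < ‖v.eval z‖ :=
  norm_eval_lt_of_mul_eq h.isCoprime (h.mul_dz z hz)
    (by rw [Complex.norm_conj]; exact jacobian_pos_iff.1 hJ)

theorem norm_eval_lt_of_jacobian_neg {z : ℂ} (hz : z ∉ P) (hJ : jacobian f z < 0) :
    ‖v.eval z‖ < ‖u.eval z‖ :=
  norm_eval_lt_of_mul_eq h.isCoprime.symm (h.mul_dz z hz).symm
    (by rw [Complex.norm_conj]; exact jacobian_neg_iff.1 hJ)

theorem eval_mul_eq_of_pole_form {A B : ℂ → ℂ} {p c : ℂ} {n : ℕ} (hn : n ≠ 0)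
    (hA : AnalyticAt ℂ A p) (hB : AnalyticAt ℂ B p)
    (hform : ∀ᶠ z in 𝓝[≠] p, f z = A z / (z - p) ^ n + starRingEnd ℂ (B z / (z - p) ^ n)
      + c * (Real.log ‖z - p‖ : ℂ)) : u.eval p * A p = v.eval p * B p := by
  have hleft : ContinuousAt (fun z => u.eval z * poleNumerator A p n c z) p :=
    u.continuousAt.mul (analyticAt_poleNumerator hA n c).continuousAt
  have hright : ContinuousAt (fun z => v.eval z * poleNumerator B p n (starRingEnd ℂ c) z) p :=
    v.continuousAt.mul (analyticAt_poleNumerator hB n _).continuousAt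
  have hlim := ((hleft.eventuallyEq_nhds_iff_eventuallyEq_nhdsNE hright).1 (by
    filter_upwards [eventually_dz_eq_of_pole hA hB hform, eventually_notMem_nhdsNE P p,
      eventually_conj_dzbar_eq_of_pole hA hB hform, self_mem_nhdsWithin] with z hdz hzP hdzbar hzp
    have hmul := h.mul_dz z hzP
    rw [hdz, hdzbar, mul_div_assoc', mul_div_assoc'] at hmul
    exact (div_left_inj' (pow_ne_zero _ (sub_ne_zero.2 hzp))).1 hmul)).self_of_nhds
  simp only [poleNumerator_self _ _ hn] at hlim
  exact mul_left_cancel₀ (neg_ne_zero.2 (Nat.cast_ne_zero.2 hn)) (by linear_combination hlim)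

section Pole

variable (hf : IsNondegenerate f P) {p : ℂ} (hp : p ∈ P)
include hf hp

theorem exists_hasLocalIndex_pole :
    ∃ k : ℤ, (∀ η, HasLocalIndex (fun z => f z - η) p k) ∧
      (‖u.eval p‖ < ‖v.eval p‖ ∧ k ≤ 0 ∨ ‖v.eval p‖ < ‖u.eval p‖ ∧ 0 ≤ k) := by
  obtain ⟨n, A, B, c, hn, hA, hB, hAB, hform⟩ := hf.pole_form p hp
  have hmul := h.eval_mul_eq_of_pole_form (Nat.one_le_iff_ne_zero.1 hn) hA hB hform
  refine ⟨if ‖B p‖ < ‖A p‖ then -n else n, fun η =>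
    hasLocalIndex_of_pole hn hA.continuousAt hB.continuousAt hAB
      ((eventually_notMem_nhdsNE P p).mono fun z hz => hf.continuousAt hz) hform η, ?_⟩
  split_ifs with hlt
  · exact Or.inl ⟨norm_eval_lt_of_mul_eq h.isCoprime hmul hlt, by lia⟩
  · exact Or.inr ⟨norm_eval_lt_of_mul_eq h.isCoprime.symm hmul.symm
      (lt_of_le_of_ne (not_lt.1 hlt) hAB), by lia⟩

theorem notMem_levelSet_of_mem : p ∉ levelSet u v := by
  obtain ⟨k, -, hlt⟩ := h.exists_hasLocalIndex_pole hf hp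
  exact hlt.elim (fun hlt => hlt.1.ne) fun hlt => hlt.1.ne'

theorem exists_hasLocalIndex_sub_of_mem (η : ℂ) : ∃ k : ℤ, HasLocalIndex (fun z => f z - η) p k ∧
    2 * (k * levelWinding u v p) + k = -|index f p| := by
  obtain ⟨k, hk, hlt⟩ := h.exists_hasLocalIndex_pole hf hp
  have hindex : index f p = k := by simpa only [sub_zero] using (hk 0).index_eq
  refine ⟨k, hk η, ?_⟩
  rw [hindex, levelWinding]
  rcases hlt with ⟨hlt, hk⟩ | ⟨hlt, hk⟩
  · rw [if_pos hlt, abs_of_nonpos (Int.cast_nonpos.2 hk)]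
    ring
  · rw [if_neg hlt.not_gt, abs_of_nonneg (Int.cast_nonneg hk)]
    ring

end Pole

theorem criticalSet_sdiff_exceptionalSet (hf : IsNondegenerate f P) :
    criticalSet f P \ exceptionalSet f P = levelSet u v := by
  ext z
  constructor
  · rintro ⟨hz, hz'⟩
    have hnorm : ‖dilatation f P z‖ = 1 := not_not.1 fun hne => hz' ⟨hz, hne⟩
    rw [h.dilatation_eq z hz.1, norm_div] at hnorm
    exact eq_of_div_eq_one hnorm
  · intro hz
    have hzP : z ∉ P := fun hp => h.notMem_levelSet_of_mem hf hp hz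
    have hv : ‖v.eval z‖ ≠ 0 := norm_ne_zero_iff.2 (eval_right_ne_zero h.isCoprime hz)
    have hnorm : ‖u.eval z‖ = ‖v.eval z‖ := hz
    refine ⟨⟨hzP, jacobian_eq_zero_iff.2 (mul_left_cancel₀ hv ?_)⟩, fun hz' => hz'.2 ?_⟩
    · rw [← Complex.norm_conj (dzbar f z), ← hnorm, ← norm_mul, h.mul_dz z hzP, hnorm, norm_mul]
    · rw [h.dilatation_eq z hzP, norm_div, hnorm, div_self hv]

theorem criticalComponents_eq (hf : IsNondegenerate f P) :
    criticalComponents f P = levelComponents u v := by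
  rw [criticalComponents, h.criticalSet_sdiff_exceptionalSet hf, levelComponents]

theorem deriv_dilatation_eq {z : ℂ} (hz : z ∉ P) (hv : v.eval z ≠ 0) :
    deriv (dilatation f P) z = -(wronskian u v).eval z / v.eval z ^ 2 := by
  have hev : dilatation f P =ᶠ[𝓝 z] fun w => u.eval w / v.eval w :=
    (eventually_notMem_nhds hz).mono h.dilatation_eq
  rw [hev.deriv_eq, ((u.hasDerivAt z).fun_div (v.hasDerivAt z) hv).deriv, wronskian, eval_sub,
    eval_mul, eval_mul, neg_sub]

theorem isCriticalCurve_iff (hf : IsNondegenerate f P) {Γ : Set ℂ} (hΓ : Γ ⊆ levelSet u v)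
    {γ : Curve} : IsCriticalCurve f P Γ γ ↔ IsLevelCurve u v Γ γ := by
  have hP : ∀ z ∈ Γ, z ∉ P := fun z hz hp => h.notMem_levelSet_of_mem hf hp (hΓ hz)
  have hv : ∀ z ∈ Γ, v.eval z ≠ 0 := fun z hz => eval_right_ne_zero h.isCoprime (hΓ hz)
  have heval : ∀ z ∈ Γ, ∀ w, dilatation f P z = w ↔ u.eval z = w * v.eval z := fun z hz w => by
    rw [h.dilatation_eq z (hP z hz), div_eq_iff (hv z hz)]
  have hderiv : ∀ z ∈ Γ, deriv (dilatation f P) z ≠ 0 ↔ (wronskian u v).eval z ≠ 0 :=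
    fun z hz => by
      rw [h.deriv_dilatation_eq (hP z hz) (hv z hz), ne_eq, div_eq_zero_iff, neg_eq_zero,
        or_iff_left (pow_ne_zero 2 (hv z hz))]
  have hmem : γ.toFun '' Icc γ.a γ.b = Γ → ∀ t ∈ Icc γ.a γ.b, γ.toFun t ∈ Γ :=
    fun htrace t ht => htrace ▸ mem_image_of_mem _ ht
  constructor
  · rintro ⟨hclosed, htrace, hdil, honce⟩
    exact ⟨hclosed, htrace, fun t ht => (heval _ (hmem htrace t ht) _).1 (hdil t ht),
      fun z hz hw => honce z hz ((hderiv z hz).2 hw)⟩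
  · rintro ⟨hclosed, htrace, hlevel, honce⟩
    exact ⟨hclosed, htrace, fun t ht => (heval _ (hmem htrace t ht) _).2 (hlevel t ht),
      fun z hz hd => honce z hz ((hderiv z hz).1 hd)⟩

theorem subset_levelSet_of_mem_criticalComponents (hf : IsNondegenerate f P) {Γ : Set ℂ}
    (hΓ : Γ ∈ criticalComponents f P) : Γ ⊆ levelSet u v := by
  rw [h.criticalComponents_eq hf] at hΓ
  obtain ⟨z, -, rfl⟩ := hΓ
  exact connectedComponentIn_subset _ _

theorem finite_criticalComponents (hf : IsNondegenerate f P) : (criticalComponents f P).Finite :=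
  h.criticalComponents_eq hf ▸ finite_levelComponents h.isCoprime h.norm_lt

theorem exists_isCriticalCurve (hf : IsNondegenerate f P) {Γ : Set ℂ}
    (hΓ : Γ ∈ criticalComponents f P) : ∃ γ, IsCriticalCurve f P Γ γ := by
  simp only [h.isCriticalCurve_iff hf (h.subset_levelSet_of_mem_criticalComponents hf hΓ)]
  exact exists_isLevelCurve h.isCoprime h.norm_lt (h.criticalComponents_eq hf ▸ hΓ)

section TotalWinding

variable (hf : IsNondegenerate f P) [Fintype (criticalComponents f P)]
  {γ : criticalComponents f P → Curve} (hγ : ∀ Γ, IsCriticalCurve f P Γ.1 (γ Γ))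
include hf hγ

theorem sum_argChange_sub_of_isCriticalCurve {x : ℂ} (hx : x ∉ levelSet u v) :
    ∑ Γ, argChange (fun t => (γ Γ).toFun t - x) (γ Γ).a (γ Γ).b = levelWinding u v x := by
  let e := Equiv.setCongr (h.criticalComponents_eq hf)
  let _ := Fintype.ofEquiv _ e
  rw [← Equiv.sum_comp e.symm]
  exact sum_argChange_sub_of_isLevelCurve h.isCoprime h.norm_lt (γ := fun Γ => γ (e.symm Γ))
    (fun Γ => (h.isCriticalCurve_iff hf
      (h.subset_levelSet_of_mem_criticalComponents hf (e.symm Γ).2)).1 (hγ (e.symm Γ))) hx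

theorem sum_winding {F : ℂ → ℂ} {S : Finset ℂ} {n : ℂ → ℤ} (hF : HasDivisor F S n)
    (hS : ∀ a ∈ S, a ∉ levelSet u v) :
    ∑ Γ, winding F (γ Γ) = ∑ a ∈ S, n a * levelWinding u v a := by
  have hnotMem : ∀ Γ, ∀ t ∈ Icc (γ Γ).a (γ Γ).b, (γ Γ).toFun t ∉ S := fun Γ t ht ha =>
    hS _ ha (h.subset_levelSet_of_mem_criticalComponents hf Γ.2
      ((hγ Γ).trace ▸ mem_image_of_mem _ ht))
  calc ∑ Γ, winding F (γ Γ)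
      = ∑ Γ, ∑ a ∈ S, n a * argChange (fun t => (γ Γ).toFun t - a) (γ Γ).a (γ Γ).b :=
        Finset.sum_congr rfl fun Γ _ => hF.argChange_comp (γ Γ).a_lt_b.le (γ Γ).continuousOn
          (hnotMem Γ) (hγ Γ).closed
    _ = ∑ a ∈ S, n a * levelWinding u v a := by
        rw [Finset.sum_comm]
        refine Finset.sum_congr rfl fun a ha => ?_
        rw [← Finset.mul_sum, h.sum_argChange_sub_of_isCriticalCurve hf hγ (hS a ha)]

end TotalWinding

section Divisor

variable (hf : IsNondegenerate f P) (hη : η ∉ f '' criticalSet f P)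
include hf hη

theorem exists_hasLocalIndex_sub_of_mem_preimages {z : ℂ} (hz : z ∈ preimages f P η) :
    ∃ k : ℤ, HasLocalIndex (fun w => f w - η) z k ∧ 2 * (k * levelWinding u v z) + k = 1 := by
  refine ⟨_, hf.hasLocalIndex_sub_of_mem_preimages hz hη, ?_⟩
  have hJ : jacobian f z ≠ 0 := fun hJ => hη ⟨z, ⟨hz.1, hJ⟩, hz.2⟩
  rw [levelWinding]
  split_ifs with hpos hlt hlt
  · norm_num
  · exact absurd (h.norm_eval_lt_of_jacobian_pos hz.1 hpos) hlt
  · exact absurd hlt (h.norm_eval_lt_of_jacobian_neg hz.1 ((not_lt.1 hpos).lt_of_ne hJ)).not_gt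
  · norm_num

theorem notMem_levelSet_of_mem_preimages {z : ℂ} (hz : z ∈ preimages f P η) :
    z ∉ levelSet u v := fun hL => by
  rw [← h.criticalSet_sdiff_exceptionalSet hf] at hL
  exact hη ⟨z, hL.1, hz.2⟩

theorem exists_hasDivisor {Z : Finset ℂ} (hZ : ∀ z, z ∈ Z ↔ z ∈ preimages f P η) :
    ∃ n : ℂ → ℤ, HasDivisor (fun z => f z - η) (P ∪ Z) n ∧
      (∀ p ∈ P, 2 * (n p * levelWinding u v p) + n p = -|index f p|) ∧
      ∀ z ∈ Z, 2 * (n z * levelWinding u v z) + n z = 1 := by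
  have hlocal : ∀ a ∈ P ∪ Z, ∃ k : ℤ, HasLocalIndex (fun z => f z - η) a k ∧
      (a ∈ P → 2 * (k * levelWinding u v a) + k = -|index f a|) ∧
      (a ∈ Z → 2 * (k * levelWinding u v a) + k = 1) := by
    intro a ha
    by_cases hP : a ∈ P
    · obtain ⟨k, hk, hw⟩ := h.exists_hasLocalIndex_sub_of_mem hf hP η
      exact ⟨k, hk, fun _ => hw, fun haZ => absurd hP ((hZ a).1 haZ).1⟩
    · obtain ⟨k, hk, hw⟩ := h.exists_hasLocalIndex_sub_of_mem_preimages hf hη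
        ((hZ a).1 ((Finset.mem_union.1 ha).resolve_left hP))
      exact ⟨k, hk, fun haP => absurd haP hP, fun _ => hw⟩
  choose! n hn hP hZ' using hlocal
  have hzP : ∀ z ∉ P ∪ Z, z ∉ P := fun z hz hp => hz (Finset.mem_union_left _ hp)
  exact ⟨n, ⟨fun z hz => (hf.continuousAt (hzP z hz)).sub continuousAt_const,
    fun z hz h0 => hz (Finset.mem_union_right _ ((hZ z).2 ⟨hzP z hz, sub_eq_zero.1 h0⟩)), hn⟩,
    fun p hp => hP p (Finset.mem_union_left _ hp) hp,
    fun z hz => hZ' z (Finset.mem_union_right _ hz) hz⟩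

end Divisor

end IsRationalDilatation

end CriticalCurves

end HarmonicMapping

open HarmonicMapping in
theorem theorem3p3 (f : ℂ → ℂ) (P : Finset ℂ) (hf : HarmonicMapping.IsNondegenerate f P)
    (η : ℂ) (hη : η ∉ f '' HarmonicMapping.criticalSet f P)
    (hinf : ∀ᶠ z in Bornology.cobounded ℂ, f z - η ≠ 0) :
    (HarmonicMapping.criticalComponents f P).Finite ∧
    (∀ Γ ∈ HarmonicMapping.criticalComponents f P,
      ∃ γ, HarmonicMapping.IsCriticalCurve f P Γ γ) ∧
    (HarmonicMapping.preimages f P η).Finite ∧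
    ∀ γ : HarmonicMapping.criticalComponents f P → HarmonicMapping.Curve,
      (∀ Γ : HarmonicMapping.criticalComponents f P, HarmonicMapping.IsCriticalCurve f P Γ.1 (γ Γ)) →
      ((HarmonicMapping.preimages f P η).ncard : ℝ) =
        2 * (∑ᶠ Γ, HarmonicMapping.winding (fun z => f z - η) (γ Γ))
          + HarmonicMapping.poleCount f P
          - HarmonicMapping.indexInfty (fun z => f z - η) := by
  classical
  obtain ⟨u, v, huv⟩ := hf.exists_isRationalDilatation
  have hΓ := huv.finite_criticalComponents hf
  have hZ := hf.finite_preimages hη hinf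
  refine ⟨hΓ, fun Γ => huv.exists_isCriticalCurve hf, hZ, fun γ hγ => ?_⟩
  let _ := hΓ.fintype
  set Z := hZ.toFinset
  have hmem : ∀ z, z ∈ Z ↔ z ∈ preimages f P η := fun z => hZ.mem_toFinset
  obtain ⟨n, hn, hpole, hzero⟩ := huv.exists_hasDivisor hf hη hmem
  have hlevel : ∀ a ∈ P ∪ Z, a ∉ levelSet u v := fun a ha => (Finset.mem_union.1 ha).elim
    (huv.notMem_levelSet_of_mem hf)
    fun ha => huv.notMem_levelSet_of_mem_preimages hf hη ((hmem a).1 ha)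
  have hdisj : Disjoint P Z := Finset.disjoint_right.2 fun z hz => ((hmem z).1 hz).1
  calc ((preimages f P η).ncard : ℝ)
      = ∑ a ∈ P ∪ Z, (2 * (n a * levelWinding u v a) + n a) + poleCount f P := by
        rw [Finset.sum_union hdisj, Finset.sum_congr rfl hpole, Finset.sum_congr rfl hzero,
          Finset.sum_neg_distrib, poleCount, neg_add_cancel_comm, Finset.sum_const, nsmul_one,
          ncard_eq_toFinset_card _ hZ]
    _ = 2 * (∑ᶠ Γ, winding (fun z => f z - η) (γ Γ)) + poleCount f P
          - indexInfty (fun z => f z - η) := by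
        rw [finsum_eq_sum_of_fintype, huv.sum_winding hf hγ hn hlevel, hn.indexInfty_eq,
          Finset.sum_add_distrib, ← Finset.mul_sum]
        ring
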